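/- Let $T>0$, let $(\Omega,\mathcal F,P)$ be a probability space and let $X=(X_t)_{t\in[0,T]}$ be a real-valued random process such that: (a) for some $\alpha>1/2$, almost every path of $X$ is Hölder continuous of order $\alpha$ on $[0,T]$; (b) for almost every $t\in[0,T]$ the random variable $X_t$ admits a probability density function $p_t$ with $\sup_{y} p_t(y)\le \hat p_t$, where $\int_0^T \hat p_t\,dt<\infty$. Let $f:\mathbb R\to\mathbb R$ be absolutely continuous (on every compact interval), with a derivative (that is, a function $f':\mathbb R\to\mathbb R$ which is the derivative of $f$ at almost every point) $f'$ of locally finite variation, and suppose that the finite limit $f'(X_{0+})=\lim_{s\downarrow 0}f'(X_s)$ exists almost surely. Then for every $t\in[0,T]$, almost surely the fractional Zähle--Stieltjes integral below exists and $$ f(X_t)-f(X_0)=\mathrm{(ZS)}\int_0^t f'(X_s)\,dX_s . $$ Here, for $a<b$, the integral $\mathrm{(ZS)}\int_a^b F\,dG$ exists if the limits $F(a+),G(a+),G(b-)$ exist in $\mathbb R$ and, for some $r\in[0,1]$ and $p,q\in[1,\infty]$ with $1/p+1/q=1$, there are $\varphi\in L_p(a,b)$ and $\psi\in L_q(a,b)$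 such that for almost every $t\in(a,b)$ $$F(t)-F(a+)=\frac1{\Gamma(r)}\int_a^t\frac{\varphi(s)}{(t-s)^{1-r}}\,ds,\qquad G(t)-G(b-)=\frac1{\Gamma(1-r)}\int_t^b\frac{\psi(s)}{(s-t)^{r}}\,ds$$ (a fractional integral of order $0$ being the identity); its value, which does not depend on the choice of $r,p,q$, is $$\mathrm{(ZS)}\int_a^b F\,dG=-\int_a^b\varphi(t)\psi(t)\,dt+F(a+)\bigl(G(b-)-G(a+)\bigr).$$ For $a=b$ the integral is $0$. -/

import Mathlib

open MeasureTheory Set Filter Topology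
open scoped NNReal ENNReal

noncomputable section

/-- The left-sided Riemann--Liouville fractional integral of order `r ≥ 0` with base point `a`,
`(I^r_{a+} φ)(t) = Γ(r)⁻¹ ∫_a^t φ(s) (t - s)^{r-1} ds`, with `I^0_{a+}` the identity. -/
def leftFracIntegral (r a : ℝ) (φ : ℝ → ℝ) (t : ℝ) : ℝ :=
  if r = 0 then φ t
  else (Real.Gamma r)⁻¹ * ∫ s in Ioo a t, φ s / (t - s) ^ (1 - r)

/-- The right-sided Riemann--Liouville fractional integral of order `r ≥ 0` with base point `b`,
`Γ(r)⁻¹ ∫_t^b φ(s) (s - t)^{r-1} ds`, and the identity for `r = 0`. It is the real operator,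
without the phase factor `(-1)^{-r} = e^{-iπr}` that some authors include. -/
def rightFracIntegral (r b : ℝ) (φ : ℝ → ℝ) (t : ℝ) : ℝ :=
  if r = 0 then φ t
  else (Real.Gamma r)⁻¹ * ∫ s in Ioo t b, φ s / (s - t) ^ (1 - r)

/-- `F ∈ I^r_{a+}(L_p(a,b))`, with left-sided fractional derivative `φ = D^r_{a+} F ∈ L_p(a,b)`,
the (almost everywhere unique) preimage of `F` under `I^r_{a+}`. -/
def IsLeftFracDeriv (r a b : ℝ) (p : ℝ≥0∞) (F φ : ℝ → ℝ) : Prop :=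
  MemLp φ p (volume.restrict (Ioo a b)) ∧
    ∀ᵐ t ∂(volume.restrict (Ioo a b)), F t = leftFracIntegral r a φ t

/-- `G ∈ I^r_{b-}(L_q(a,b))`, with (phase-free) right-sided fractional derivative
`ψ ∈ L_q(a,b)`, the (almost everywhere unique) preimage of `G` under `I^r_{b-}`. -/
def IsRightFracDeriv (r a b : ℝ) (q : ℝ≥0∞) (G ψ : ℝ → ℝ) : Prop :=
  MemLp ψ q (volume.restrict (Ioo a b)) ∧
    ∀ᵐ t ∂(volume.restrict (Ioo a b)), G t = rightFracIntegral r b ψ t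

/-- The fractional Zähle--Stieltjes integral `(ZS) ∫_a^b F dG` exists and equals `I`:
the limits `F(a+)`, `G(a+)`, `G(b-)` exist, and for some `r ∈ [0,1]` and conjugate `p, q ∈ [1,∞]`
one has `F - F(a+) ∈ I^r_{a+}(L_p)` and `G - G(b-) ∈ I^{1-r}_{b-}(L_q)`, and
`I = (-1)^r ∫_a^b D^r_{a+}(F - F(a+)) D^{1-r}_{b-}(G - G(b-)) dt + F(a+) (G(b-) - G(a+))`.
The phase `(-1)^r` in front of the integral times the phase `(-1)^{1-r}` of the right-sided
derivative is `e^{iπr} e^{iπ(1-r)} = -1`, whence the minus sign in front of the integral of the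
phase-free derivatives. The integral over a degenerate interval is `0`. -/
def HasZSIntegral (F G : ℝ → ℝ) (a b I : ℝ) : Prop :=
  (a = b ∧ I = 0) ∨
  (a < b ∧ ∃ Fa Ga Gb : ℝ,
    Tendsto F (𝓝[>] a) (𝓝 Fa) ∧ Tendsto G (𝓝[>] a) (𝓝 Ga) ∧ Tendsto G (𝓝[<] b) (𝓝 Gb) ∧
    ∃ r ∈ Icc (0 : ℝ) 1, ∃ p q : ℝ≥0∞, p.HolderConjugate q ∧
    ∃ φ ψ : ℝ → ℝ,
      IsLeftFracDeriv r a b p (fun t => F t - Fa) φ ∧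
      IsRightFracDeriv (1 - r) a b q (fun t => G t - Gb) ψ ∧
      I = -(∫ t in Ioo a b, φ t * ψ t) + Fa * (Gb - Ga))

/-- For almost every `t ∈ [0,T]` the random variable `X t` has a probability density function that
is bounded by `phat t`, where `phat` is integrable over `[0,T]`. -/
def HasIntegrablyBoundedDensities {Ω : Type*} [MeasurableSpace Ω] (P : Measure Ω)
    (X : ℝ → Ω → ℝ) (T : ℝ) : Prop :=
  ∃ phat : ℝ → ℝ, IntegrableOn phat (Icc 0 T) ∧
    ∀ᵐ t ∂(volume.restrict (Icc 0 T)), ∃ p : ℝ → ℝ,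
      Measurable p ∧ (∀ y, 0 ≤ p y) ∧
      P.map (X t) = volume.withDensity (fun y => ENNReal.ofReal (p y)) ∧
      ∀ y, p y ≤ phat t

/-- Almost every path of `X` is Hölder continuous of order `α` on `[0,T]`. -/
def HasHolderPaths {Ω : Type*} [MeasurableSpace Ω] (P : Measure Ω)
    (X : ℝ → Ω → ℝ) (T : ℝ) (α : ℝ≥0) : Prop :=
  ∀ᵐ ω ∂P, ∃ C : ℝ≥0, HolderOnWith C α (fun t => X t ω) (Icc 0 T)

end

/-! The integral is realised with r = 1/2, p = 1, q = ∞. Since α > 1/2, the path G = X(ω), minus its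
end value, has a bounded right half-derivative ψ, given by Marchaud's formula. For F = f'(G) -
F(0+), which is merely bounded, the Marchaud formula gives an L¹ half-derivative φ as soon as |F(s)
- F(u)| (s - u)^(-3/2) is integrable over u < s; then `isLeftFracDeriv_marchaud` inverts the
half-integral.

This integrability is the only probabilistic point. Write f' as a difference of monotone functions
and let V be their sum. Hölder continuity gives |F(s) - F(s - v)| ≤ V(G(s) + K v^α) - V(G(s) - K
v^α). Integrated over a compact set of space points in place of G(s), the right side is O(v^α), even
if V jumps (`Monotone.lintegral_sub_le`), and v^(α - 3/2) is integrable at 0. The density bound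
transfers finiteness from Lebesgue measure in space to almost every path
(`HasIntegrablyBoundedDensities.ae_lintegral_lt_top`).

For the value, fractional integration by parts and Lebesgue differentiation show that -∫ φψ is the
limit of ∫ F(t) (G(t+ε) - G(t))/ε dt (`tendsto_setIntegral_mul_diffQuot`). The corresponding
integral of (f(G(t+ε)) - f(G(t)))/ε telescopes to f(G(b)) - f(G(0)). The two differ, apart from the
F(0+) term, by a Taylor remainder at most K ε^(α-1) times the modulus above with v = ε. The double
integral already known to be finite forces the time integral of that modulus to be O(ε^(1/2))
(`lintegral_modulus_le`), so the remainder is O(ε^(α - 1/2)) and vanishes. -/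

/-! ### The Abel kernel and half-order integrals -/

/-- The kernel `x ^ (-1/2)` on the positive half-line, extended by zero. -/
noncomputable def halfKernel (x : ℝ) : ℝ := if 0 < x then x ^ (-(1 / 2) : ℝ) else 0

lemma halfKernel_nonneg (x : ℝ) : 0 ≤ halfKernel x := by
  unfold halfKernel; split_ifs with h
  · positivity
  · exact le_rfl

lemma measurable_halfKernel : Measurable halfKernel :=
  Measurable.ite measurableSet_Ioi (measurable_id.pow_const _) measurable_const

/-- This is B(1/2, 1/2) = Γ(1/2)² / Γ(1); scaling contributes c^0, so the value is independent of c.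
-/
lemma integral_rpow_neg_half_mul {c : ℝ} (hc : 0 < c) :
    ∫ x in Ioo 0 c, x ^ (-(1 / 2) : ℝ) * (c - x) ^ (-(1 / 2) : ℝ) = Real.pi := by
  have h := Complex.betaIntegral_scaled (1 / 2) (1 / 2) hc
  have hb : Complex.betaIntegral (1 / 2) (1 / 2) = (Real.pi : ℂ) := by
    have h1 := Complex.Gamma_mul_Gamma_eq_betaIntegral (s := 1 / 2) (t := 1 / 2)
      (by norm_num) (by norm_num)
    rw [add_halves, Complex.Gamma_one, one_mul] at h1
    rw [← h1]
    have h2 : Complex.Gamma (1 / 2) = ((Real.Gamma (1 / 2) : ℝ) : ℂ) := by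
      rw [← Complex.Gamma_ofReal]; norm_num
    rw [h2, Real.Gamma_one_half_eq, ← Complex.ofReal_mul, Real.mul_self_sqrt Real.pi_pos.le]
  rw [hb, add_halves, sub_self, Complex.cpow_zero, one_mul,
    intervalIntegral.integral_of_le hc.le, integral_Ioc_eq_integral_Ioo] at h
  rw [← Complex.ofReal_inj, ← integral_complex_ofReal, ← h]
  refine setIntegral_congr_fun measurableSet_Ioo fun x hx => ?_
  have h1 : 0 ≤ x := hx.1.le
  have h2 : 0 ≤ c - x := by linarith [hx.2]
  simp only [Complex.ofReal_mul, Complex.ofReal_cpow h1, Complex.ofReal_cpow h2]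
  norm_num

/-- The Beta integral: the kernel convolved with itself is π times the Heaviside function. All
semigroup identities below rest on this. -/
lemma integral_halfKernel_mul (s t : ℝ) :
    ∫ u, halfKernel (t - u) * halfKernel (u - s) = if s < t then Real.pi else 0 := by
  split_ifs with h
  · have : (fun u => halfKernel (t - u) * halfKernel (u - s)) =
        fun u => (Ioo 0 (t - s)).indicator
          (fun x => x ^ (-(1 / 2) : ℝ) * ((t - s) - x) ^ (-(1 / 2) : ℝ)) (u - s) := by
      funext u
      simp only [halfKernel, indicator, mem_Ioo]
      by_cases h1 : 0 < t - u <;> by_cases h2 : 0 < u - s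
      · rw [if_pos h1, if_pos h2, if_pos ⟨h2, by linarith⟩, mul_comm]
        congr 2; ring
      all_goals
        first
        | rw [if_neg h1, zero_mul, if_neg (fun h => h1 (by linarith [h.2]))]
        | rw [if_neg h2, mul_zero, if_neg (fun h => h2 h.1)]
    rw [this, integral_sub_right_eq_self
      ((Ioo 0 (t - s)).indicator (fun x => x ^ (-(1 / 2) : ℝ) * ((t - s) - x) ^ (-(1 / 2) : ℝ))) s,
      integral_indicator measurableSet_Ioo, integral_rpow_neg_half_mul (by linarith)]
  · rw [← integral_zero ℝ ℝ (μ := volume)]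
    congr 1
    funext u
    simp only [halfKernel]
    by_cases h1 : 0 < t - u
    · rw [if_neg (c := 0 < u - s) (by linarith), mul_zero]
    · rw [if_neg h1, zero_mul]

lemma integrable_halfKernel_mul (s t : ℝ) :
    Integrable fun u => halfKernel (t - u) * halfKernel (u - s) := by
  by_cases h : s < t
  -- A non-integrable function has Bochner integral 0, whereas this integral equals π.
  · by_contra hi
    have := integral_halfKernel_mul s t
    rw [integral_undef hi, if_pos h] at this
    exact Real.pi_ne_zero this.symm
  · have : (fun u => halfKernel (t - u) * halfKernel (u - s)) = fun _ => 0 := by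
      funext u
      simp only [halfKernel]
      by_cases h1 : 0 < t - u
      · rw [if_neg (c := 0 < u - s) (by linarith), mul_zero]
      · rw [if_neg h1, zero_mul]
    rw [this]; exact integrable_zero _ _ _

lemma integrableOn_halfKernel (a b : ℝ) : IntegrableOn halfKernel (Ioc a b) := by
  have h0 : IntegrableOn halfKernel (Ioc 0 b) := by
    rcases le_total b 0 with hb | hb
    · simp [Ioc_eq_empty (not_lt.2 hb)]
    have := (intervalIntegral.intervalIntegrable_rpow' (a := 0) (b := b)
      (r := -(1 / 2)) (by norm_num)).1
    exact this.congr_fun (fun x hx => by simp [halfKernel, hx.1]) measurableSet_Ioc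
  have h1 : IntegrableOn halfKernel (Iic 0) :=
    integrableOn_zero.congr_fun (fun x hx => by simp [halfKernel, not_lt.2 (mem_Iic.1 hx)]) measurableSet_Iic
  refine (h1.union h0).mono_set fun x hx => ?_
  rcases le_or_gt x 0 with h | h
  · exact Or.inl h
  · exact Or.inr ⟨h, hx.2⟩

/-- Whole-line convolution form, suited to Fubini. Cutting φ at b instead of t changes nothing,
because the kernel vanishes for s ≥ t. -/
lemma leftFracIntegral_half (φ : ℝ → ℝ) {b t : ℝ} (ht : t ≤ b) :
    leftFracIntegral (1 / 2) 0 φ t =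
      (√Real.pi)⁻¹ * ∫ s, (Ioo 0 b).indicator φ s * halfKernel (t - s) := by
  rw [leftFracIntegral, if_neg (by norm_num), Real.Gamma_one_half_eq,
    ← integral_indicator measurableSet_Ioo]
  congr 2
  funext s
  simp only [indicator, halfKernel, mem_Ioo]
  by_cases h0 : 0 < s <;> by_cases h1 : s < t
  · have h2 : 0 < t - s := by linarith
    rw [if_pos ⟨h0, h1⟩, if_pos ⟨h0, by linarith⟩, if_pos h2, Real.rpow_neg h2.le, div_eq_mul_inv]
    norm_num
  · simp [h1]
  · simp [h0]
  · simp [h0]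

lemma rightFracIntegral_half (ψ : ℝ → ℝ) {b t : ℝ} (ht : 0 ≤ t) :
    rightFracIntegral (1 / 2) b ψ t =
      (√Real.pi)⁻¹ * ∫ s, (Ioo 0 b).indicator ψ s * halfKernel (s - t) := by
  rw [rightFracIntegral, if_neg (by norm_num), Real.Gamma_one_half_eq,
    ← integral_indicator measurableSet_Ioo]
  congr 2
  funext s
  simp only [indicator, halfKernel, mem_Ioo]
  by_cases h0 : s < b <;> by_cases h1 : t < s
  · have h2 : 0 < s - t := by linarith
    rw [if_pos ⟨h1, h0⟩, if_pos ⟨by linarith, h0⟩, if_pos h2, Real.rpow_neg h2.le, div_eq_mul_inv]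
    norm_num
  · simp [h1]
  · simp [h0]
  · simp [h0]

/-- The reflection s ↦ b - s reduces right-sided statements to left-sided ones. -/
lemma rightFracIntegral_eq_leftFracIntegral (ψ : ℝ → ℝ) (r b t : ℝ) :
    rightFracIntegral r b ψ t = leftFracIntegral r 0 (fun s => ψ (b - s)) (b - t) := by
  unfold rightFracIntegral leftFracIntegral
  split_ifs with h
  · simp
  · congr 1
    rw [← integral_indicator measurableSet_Ioo, ← integral_indicator measurableSet_Ioo,
      ← integral_sub_left_eq_self _ volume b]
    congr 1
    funext s
    simp only [indicator, mem_Ioo]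
    by_cases h1 : 0 < s ∧ s < b - t
    · rw [if_pos h1, if_pos ⟨by linarith, by linarith⟩]
      congr 2; ring
    · rw [if_neg h1, if_neg (fun h => h1 ⟨by linarith, by linarith⟩)]

/-! ### The semigroup identity -/

/-- Integrability of the product in the semigroup identity. -/
lemma integrable_mul_halfKernel_mul_halfKernel {w : ℝ → ℝ} (hw : Integrable w) (t : ℝ) :
    Integrable (fun z : ℝ × ℝ => w z.2 * (halfKernel (t - z.1) * halfKernel (z.1 - z.2)))
      (volume.prod volume) := by
  have hm : AEStronglyMeasurable
      (fun z : ℝ × ℝ => w z.2 * (halfKernel (t - z.1) * halfKernel (z.1 - z.2)))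
      (volume.prod volume) :=
    hw.aestronglyMeasurable.comp_snd.mul
      ((measurable_halfKernel.comp (measurable_const.sub measurable_fst)).mul
        (measurable_halfKernel.comp (measurable_fst.sub measurable_snd))).aestronglyMeasurable
  rw [integrable_prod_iff' hm]
  refine ⟨ae_of_all _ fun s => (integrable_halfKernel_mul s t).const_mul (w s), ?_⟩
  have : (fun s => ∫ u, ‖w s * (halfKernel (t - u) * halfKernel (u - s))‖) =
      fun s => (Iio t).indicator (fun s => ‖w s‖ * Real.pi) s := by
    funext s
    simp_rw [norm_mul, Real.norm_of_nonneg (halfKernel_nonneg _)]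
    rw [integral_const_mul, integral_halfKernel_mul]
    simp [indicator]
  simp only [this]
  exact (hw.norm.mul_const _).indicator measurableSet_Iio

/-- The semigroup property: the half-integral of the half-integral is the integral. -/
lemma integral_halfKernel_mul_integral {w : ℝ → ℝ} (hw : Integrable w) (t : ℝ) :
    ∫ u, halfKernel (t - u) * ∫ s, w s * halfKernel (u - s) = Real.pi * ∫ s in Iio t, w s := by
  have h := integral_integral_swap
    (f := fun u s => w s * (halfKernel (t - u) * halfKernel (u - s))) (integrable_mul_halfKernel_mul_halfKernel hw t)
  calc _ = ∫ u, ∫ s, w s * (halfKernel (t - u) * halfKernel (u - s)) := by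
        congr 1; funext u; rw [← integral_const_mul]; congr 1; funext s; ring
    _ = ∫ s, ∫ u, w s * (halfKernel (t - u) * halfKernel (u - s)) := h
    _ = ∫ s, (Iio t).indicator (fun s => Real.pi * w s) s := by
        congr 1; funext s
        rw [integral_const_mul, integral_halfKernel_mul]
        simp [indicator, mul_comm]
    _ = _ := by rw [integral_indicator measurableSet_Iio, integral_const_mul]

lemma integral_halfKernel_mul_integral' {w : ℝ → ℝ} (hw : Integrable w) (t : ℝ) :
    ∫ u, halfKernel (u - t) * ∫ s, w s * halfKernel (s - u) = Real.pi * ∫ s in Ioi t, w s := by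
  have h := integral_halfKernel_mul_integral hw.comp_neg (-t)
  have h2 : ∫ s in Iio (-t), w (-s) = ∫ s in Ioi t, w s := by
    rw [← integral_Iic_eq_integral_Iio, integral_comp_neg_Iic, neg_neg]
  rw [h2] at h
  rw [← h, ← integral_neg_eq_self]
  congr 1; funext u
  rw [← integral_neg_eq_self (fun s => w s * halfKernel (s - -u))]
  congr 1
  · congr 1; ring
  · congr 1; funext s; congr 2; ring

/-! ### The integrated Marchaud formula, by regularising the singular kernel -/

lemma integral_add_rpow_neg_three_half {ε c : ℝ} (hε : 0 < ε) (hc : 0 ≤ c) :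
    ∫ x in Ioo 0 c, (x + ε) ^ (-(3 / 2) : ℝ) =
      2 * (ε ^ (-(1 / 2) : ℝ) - (c + ε) ^ (-(1 / 2) : ℝ)) := by
  rw [← integral_Ioc_eq_integral_Ioo, ← intervalIntegral.integral_of_le hc,
    intervalIntegral.integral_comp_add_right (fun x => x ^ (-(3 / 2) : ℝ)),
    integral_rpow (Or.inr ⟨by norm_num, ?_⟩)]
  · norm_num; ring
  · rw [uIcc_of_le (by linarith)]
    intro h
    linarith [h.1]

/-- The integrand `x ^ (-3/2)`, shifted by `ε`, on the positive half-line. -/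
noncomputable def shiftKernel (ε x : ℝ) : ℝ := if 0 < x then (x + ε) ^ (-(3 / 2) : ℝ) else 0

lemma measurable_shiftKernel (ε : ℝ) : Measurable (shiftKernel ε) :=
  Measurable.ite measurableSet_Ioi ((measurable_id.add_const ε).pow_const _) measurable_const

lemma shiftKernel_nonneg {ε : ℝ} (hε : 0 ≤ ε) (x : ℝ) : 0 ≤ shiftKernel ε x := by
  unfold shiftKernel; split_ifs with h
  · positivity
  · exact le_rfl

lemma shiftKernel_le {ε : ℝ} (hε : 0 < ε) (x : ℝ) :
    shiftKernel ε x ≤ ε ^ (-(3 / 2) : ℝ) := by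
  unfold shiftKernel; split_ifs with h
  · exact Real.rpow_le_rpow_of_nonpos hε (by linarith) (by norm_num)
  · positivity

/-- Supplies the majorant, independent of ε, for the passage ε ↓ 0. -/
lemma shiftKernel_le_zero {ε : ℝ} (hε : 0 ≤ ε) (x : ℝ) :
    shiftKernel ε x ≤ shiftKernel 0 x := by
  unfold shiftKernel; split_ifs with h
  · exact Real.rpow_le_rpow_of_nonpos (by linarith) (by linarith) (by norm_num)
  · exact le_rfl

lemma tendsto_shiftKernel (x : ℝ) :
    Tendsto (fun ε => shiftKernel ε x) (𝓝[>] 0) (𝓝 (shiftKernel 0 x)) := by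
  unfold shiftKernel; split_ifs with h
  · have : ContinuousAt (fun ε : ℝ => (x + ε) ^ (-(3 / 2) : ℝ)) 0 :=
      ContinuousAt.rpow_const (by fun_prop) (Or.inl (by simpa using h.ne'))
    exact this.tendsto.mono_left nhdsWithin_le_nhds
  · exact tendsto_const_nhds

lemma setIntegral_shiftKernel_left {t u ε : ℝ} (hu : u ∈ Ioo 0 t) (hε : 0 < ε) :
    ∫ s in Ioo 0 t, shiftKernel ε (s - u) =
      2 * (ε ^ (-(1 / 2) : ℝ) - (t - u + ε) ^ (-(1 / 2) : ℝ)) := by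
  rw [← integral_add_rpow_neg_three_half hε (by linarith [hu.2]),
    ← integral_indicator measurableSet_Ioo, ← integral_indicator measurableSet_Ioo,
    ← integral_add_right_eq_self _ u]
  congr 1; funext x
  simp only [indicator, mem_Ioo, shiftKernel]
  by_cases h : 0 < x ∧ x < t - u
  · rw [if_pos h, if_pos ⟨by linarith [hu.1], by linarith⟩, if_pos (by linarith)]
    congr 2; ring
  · rw [if_neg h]
    by_cases h0 : 0 < x
    · rw [if_neg (fun h1 => h ⟨h0, by linarith⟩)]
    · rw [if_neg (c := 0 < x + u - u) (by linarith)]; simp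

/-- Makes the inner domain independent of s, so that Fubini can be used on a square. -/
lemma setIntegral_shiftKernel_right_eq (F : ℝ → ℝ) {t s : ℝ} (hs : s ∈ Ioo 0 t) (ε : ℝ) :
    ∫ u in Ioo 0 t, F u * shiftKernel ε (s - u) =
      ∫ u in Ioo 0 s, F u * (s - u + ε) ^ (-(3 / 2) : ℝ) := by
  rw [← integral_indicator measurableSet_Ioo, ← integral_indicator measurableSet_Ioo]
  congr 1; funext x
  simp only [indicator, mem_Ioo, shiftKernel]
  by_cases h : 0 < x ∧ x < s
  · rw [if_pos h, if_pos ⟨h.1, by linarith [hs.2]⟩, if_pos (by linarith)]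
  · rw [if_neg h]
    by_cases h0 : 0 < x
    · rw [if_neg (c := 0 < s - x) (fun h1 => h ⟨h0, by linarith⟩)]; simp
    · rw [if_neg (fun h => h0 h.1)]

lemma setIntegral_shiftKernel_right {t s ε : ℝ} (hs : s ∈ Ioo 0 t) (hε : 0 < ε) :
    ∫ u in Ioo 0 t, shiftKernel ε (s - u) =
      2 * (ε ^ (-(1 / 2) : ℝ) - (s + ε) ^ (-(1 / 2) : ℝ)) := by
  have := setIntegral_shiftKernel_right_eq (fun _ => 1) hs ε
  simp only [one_mul] at this
  rw [this, ← integral_add_rpow_neg_three_half hε (by linarith [hs.1]),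
    ← integral_indicator measurableSet_Ioo, ← integral_indicator measurableSet_Ioo,
    ← integral_sub_left_eq_self _ volume s]
  congr 1; funext x
  simp only [indicator, mem_Ioo, sub_sub_cancel]
  congr 1
  simp only [sub_pos, sub_lt_self_iff, eq_iff_iff]
  tauto

lemma integrable_of_measurable_of_le {α : Type*} [MeasurableSpace α] {μ : Measure α}
    [IsFiniteMeasure μ] {f : α → ℝ} (hf : Measurable f) {M : ℝ} (hM : ∀ x, |f x| ≤ M) :
    Integrable f μ :=
  Integrable.of_bound hf.aestronglyMeasurable M (ae_of_all _ hM)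

/-- For ε > 0 the terms with F(s) and F(u) can be integrated separately, each in the variable that F
does not contain. Both produce the same term in ε^(-1/2), divergent as ε ↓ 0; it cancels in the
difference and only the boundary terms remain. -/
lemma integral_marchaud_shift {F : ℝ → ℝ} (hF : Measurable F) {M : ℝ} (hM : ∀ s, |F s| ≤ M)
    (t : ℝ) {ε : ℝ} (hε : 0 < ε) :
    (∫ s in Ioo 0 t, F s * (s + ε) ^ (-(1 / 2) : ℝ)) + 1 / 2 * ∫ z, (F z.1 - F z.2) *
        shiftKernel ε (z.1 - z.2) ∂((volume.restrict (Ioo 0 t)).prod (volume.restrict (Ioo 0 t))) =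
      ∫ u in Ioo 0 t, F u * (t - u + ε) ^ (-(1 / 2) : ℝ) := by
  set μ := (volume : Measure ℝ).restrict (Ioo 0 t) with hμ
  have hk : Measurable fun z : ℝ × ℝ => shiftKernel ε (z.1 - z.2) :=
    (measurable_shiftKernel ε).comp (measurable_fst.sub measurable_snd)
  have hkb : ∀ z : ℝ × ℝ, |shiftKernel ε (z.1 - z.2)| ≤ ε ^ (-(3 / 2) : ℝ) := fun z => by
    rw [abs_of_nonneg (shiftKernel_nonneg hε.le _)]; exact shiftKernel_le hε _
  have hM0 : 0 ≤ M := (abs_nonneg _).trans (hM 0)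
  have i1 : Integrable (fun z : ℝ × ℝ => F z.1 * shiftKernel ε (z.1 - z.2)) (μ.prod μ) :=
    integrable_of_measurable_of_le ((hF.comp measurable_fst).mul hk)
      (M := M * ε ^ (-(3 / 2) : ℝ)) fun z => by
        rw [abs_mul]; exact mul_le_mul (hM _) (hkb z) (abs_nonneg _) hM0
  have i2 : Integrable (fun z : ℝ × ℝ => F z.2 * shiftKernel ε (z.1 - z.2)) (μ.prod μ) :=
    integrable_of_measurable_of_le ((hF.comp measurable_snd).mul hk)
      (M := M * ε ^ (-(3 / 2) : ℝ)) fun z => by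
        rw [abs_mul]; exact mul_le_mul (hM _) (hkb z) (abs_nonneg _) hM0
  have hpow : ∀ {x : ℝ}, 0 < x → (x + ε) ^ (-(1 / 2) : ℝ) ≤ ε ^ (-(1 / 2) : ℝ) := fun {x} hx =>
    Real.rpow_le_rpow_of_nonpos hε (by linarith) (by norm_num)
  have hFi : Integrable F μ := integrable_of_measurable_of_le hF hM
  have j1 : Integrable (fun s => F s * (s + ε) ^ (-(1 / 2) : ℝ)) μ := by
    refine hFi.mul_bdd (c := ε ^ (-(1 / 2) : ℝ))
      ((measurable_id.add_const ε).pow_const _).aestronglyMeasurable ?_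
    filter_upwards [ae_restrict_mem measurableSet_Ioo] with x hx
    have := hx.1
    rw [Real.norm_of_nonneg (by positivity)]; exact hpow this
  have j2 : Integrable (fun u => F u * (t - u + ε) ^ (-(1 / 2) : ℝ)) μ := by
    refine hFi.mul_bdd (c := ε ^ (-(1 / 2) : ℝ))
      (((measurable_const.sub measurable_id).add_const ε).pow_const _).aestronglyMeasurable ?_
    filter_upwards [ae_restrict_mem measurableSet_Ioo] with x hx
    have : 0 < t - x := by linarith [hx.2]
    rw [Real.norm_of_nonneg (by positivity)]; exact hpow this
  have j0 : Integrable (fun s => F s * ε ^ (-(1 / 2) : ℝ)) μ := hFi.mul_const _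
  have e1 : ∫ z, F z.1 * shiftKernel ε (z.1 - z.2) ∂(μ.prod μ) =
      2 * (∫ s, F s * ε ^ (-(1 / 2) : ℝ) ∂μ - ∫ s, F s * (s + ε) ^ (-(1 / 2) : ℝ) ∂μ) := by
    rw [integral_prod _ i1, ← integral_sub j0 j1, ← integral_const_mul]
    refine setIntegral_congr_fun measurableSet_Ioo fun s hs => ?_
    simp only
    rw [integral_const_mul, setIntegral_shiftKernel_right hs hε]
    ring
  have e2 : ∫ z, F z.2 * shiftKernel ε (z.1 - z.2) ∂(μ.prod μ) =
      2 * (∫ s, F s * ε ^ (-(1 / 2) : ℝ) ∂μ - ∫ s, F s * (t - s + ε) ^ (-(1 / 2) : ℝ) ∂μ) := by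
    rw [integral_prod_symm _ i2, ← integral_sub j0 j2, ← integral_const_mul]
    refine setIntegral_congr_fun measurableSet_Ioo fun s hs => ?_
    simp only
    rw [integral_const_mul, setIntegral_shiftKernel_left hs hε]
    ring
  simp_rw [sub_mul]
  rw [integral_sub i1 i2, e1, e2]
  ring

lemma integrableOn_rpow_neg_half (t : ℝ) :
    IntegrableOn (fun s : ℝ => s ^ (-(1 / 2) : ℝ)) (Ioo 0 t) :=
  ((integrableOn_halfKernel 0 t).mono_set Ioo_subset_Ioc_self).congr_fun
    (fun x hx => by simp [halfKernel, hx.1]) measurableSet_Ioo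

lemma integrableOn_sub_rpow_neg_half (t : ℝ) :
    IntegrableOn (fun s : ℝ => (t - s) ^ (-(1 / 2) : ℝ)) (Ioo 0 t) := by
  rw [← integrable_indicator_iff measurableSet_Ioo]
  have := ((integrable_indicator_iff measurableSet_Ioo).2
    (integrableOn_rpow_neg_half t)).comp_sub_left t
  refine this.congr (ae_of_all _ fun s => ?_)
  simp only [indicator, mem_Ioo]
  congr 1
  simp only [sub_pos, sub_lt_self_iff, eq_iff_iff]
  tauto

/-- Dominated convergence as ε ↓ 0 in the regularised identity. Up to the factor 1/√π it says that
the primitive of the Marchaud derivative is the half-integral of F. -/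
lemma integral_marchaud {F : ℝ → ℝ} (hF : Measurable F) {M : ℝ} (hM : ∀ s, |F s| ≤ M)
    {t : ℝ} (hint : Integrable (fun z : ℝ × ℝ => (F z.1 - F z.2) * shiftKernel 0 (z.1 - z.2))
      ((volume.restrict (Ioo 0 t)).prod (volume.restrict (Ioo 0 t)))) :
    (∫ s in Ioo 0 t, F s * s ^ (-(1 / 2) : ℝ)) + 1 / 2 * ∫ z, (F z.1 - F z.2) *
        shiftKernel 0 (z.1 - z.2) ∂((volume.restrict (Ioo 0 t)).prod (volume.restrict (Ioo 0 t))) =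
      ∫ u in Ioo 0 t, F u * (t - u) ^ (-(1 / 2) : ℝ) := by
  have hM0 : 0 ≤ M := (abs_nonneg _).trans (hM 0)
  have key : ∀ {y : ℝ}, 0 < y → ∀ᶠ ε : ℝ in 𝓝[>] 0, (y + ε) ^ (-(1 / 2) : ℝ) ≤
      y ^ (-(1 / 2) : ℝ) := fun {y} hy => by
    filter_upwards [self_mem_nhdsWithin] with ε hε
    exact Real.rpow_le_rpow_of_nonpos hy (by linarith [mem_Ioi.1 hε]) (by norm_num)
  have lim : ∀ {y : ℝ}, 0 < y →
      Tendsto (fun ε : ℝ => (y + ε) ^ (-(1 / 2) : ℝ)) (𝓝[>] 0) (𝓝 (y ^ (-(1 / 2) : ℝ))) := by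
    intro y hy
    have : ContinuousAt (fun ε : ℝ => (y + ε) ^ (-(1 / 2) : ℝ)) 0 :=
      ContinuousAt.rpow_const (by fun_prop) (Or.inl (by simpa using hy.ne'))
    simpa using this.tendsto.mono_left nhdsWithin_le_nhds
  have T : ∀ g : ℝ → ℝ, Measurable g → (∀ s ∈ Ioo 0 t, 0 < g s) →
      IntegrableOn (fun s => g s ^ (-(1 / 2) : ℝ)) (Ioo 0 t) →
      Tendsto (fun ε : ℝ => ∫ s in Ioo 0 t, F s * (g s + ε) ^ (-(1 / 2) : ℝ)) (𝓝[>] 0)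
        (𝓝 (∫ s in Ioo 0 t, F s * g s ^ (-(1 / 2) : ℝ))) := by
    intro g hg hpos hi
    refine tendsto_integral_filter_of_dominated_convergence
      (fun s => M * g s ^ (-(1 / 2) : ℝ)) ?_ ?_ (hi.const_mul M) ?_
    · exact Eventually.of_forall fun ε =>
        (hF.mul ((hg.add_const ε).pow_const _)).aestronglyMeasurable
    · filter_upwards [self_mem_nhdsWithin] with ε hε
      filter_upwards [ae_restrict_mem measurableSet_Ioo] with s hs
      have h1 := hpos s hs
      have h2 : 0 < ε := hε
      rw [norm_mul, Real.norm_of_nonneg (r := (g s + ε) ^ (-(1 / 2) : ℝ)) (by positivity)]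
      exact mul_le_mul (hM s)
        (Real.rpow_le_rpow_of_nonpos h1 (by linarith) (by norm_num)) (by positivity) hM0
    · filter_upwards [ae_restrict_mem measurableSet_Ioo] with s hs
      exact (lim (hpos s hs)).const_mul _
  have T1 := T id measurable_id (fun s hs => hs.1) (integrableOn_rpow_neg_half t)
  have T2 := T (fun s => t - s) (measurable_const.sub measurable_id)
    (fun s hs => by linarith [hs.2]) (integrableOn_sub_rpow_neg_half t)
  have T3 : Tendsto (fun ε : ℝ => ∫ z, (F z.1 - F z.2) * shiftKernel ε (z.1 - z.2)
        ∂((volume.restrict (Ioo 0 t)).prod (volume.restrict (Ioo 0 t)))) (𝓝[>] 0)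
      (𝓝 (∫ z, (F z.1 - F z.2) * shiftKernel 0 (z.1 - z.2)
        ∂((volume.restrict (Ioo 0 t)).prod (volume.restrict (Ioo 0 t))))) := by
    refine tendsto_integral_filter_of_dominated_convergence _ ?_ ?_ hint.norm ?_
    · exact Eventually.of_forall fun ε =>
        (((hF.comp measurable_fst).sub (hF.comp measurable_snd)).mul
          ((measurable_shiftKernel ε).comp
            (measurable_fst.sub measurable_snd))).aestronglyMeasurable
    · filter_upwards [self_mem_nhdsWithin] with ε hε
      refine ae_of_all _ fun z => ?_
      rw [norm_mul, norm_mul, Real.norm_of_nonneg (shiftKernel_nonneg (le_of_lt hε) _),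
        Real.norm_of_nonneg (shiftKernel_nonneg le_rfl _)]
      exact mul_le_mul_of_nonneg_left (shiftKernel_le_zero (le_of_lt hε) _) (norm_nonneg _)
    · exact ae_of_all _ fun z => (tendsto_shiftKernel _).const_mul _
  refine tendsto_nhds_unique (T1.add (T3.const_mul (1 / 2))) (T2.congr' ?_)
  filter_upwards [self_mem_nhdsWithin] with ε hε
  exact (integral_marchaud_shift hF hM t hε).symm

/-! ### Inversion of the half-integral -/

/-- The Marchaud form of the left-sided fractional derivative of order `1/2` with base point `0`. -/
noncomputable def marchaud (F : ℝ → ℝ) (s : ℝ) : ℝ :=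
  (√Real.pi)⁻¹ * (F s * s ^ (-(1 / 2) : ℝ) +
    1 / 2 * ∫ u in Ioo 0 s, (F s - F u) * (s - u) ^ (-(3 / 2) : ℝ))

lemma marchaud_eq_of_mem (F : ℝ → ℝ) {b s : ℝ} (hs : s ∈ Ioo 0 b) :
    marchaud F s = (√Real.pi)⁻¹ * (F s * s ^ (-(1 / 2) : ℝ) +
      1 / 2 * ∫ u in Ioo 0 b, (F s - F u) * shiftKernel 0 (s - u)) := by
  rw [setIntegral_shiftKernel_right_eq (fun u => F s - F u) hs 0]
  simp only [add_zero, marchaud]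

section Inversion

variable {F : ℝ → ℝ} {M b : ℝ}

lemma integrableOn_marchaud (hF : Measurable F) (hM : ∀ s, |F s| ≤ M)
    (hint : Integrable (fun z : ℝ × ℝ => (F z.1 - F z.2) * shiftKernel 0 (z.1 - z.2))
      ((volume.restrict (Ioo 0 b)).prod (volume.restrict (Ioo 0 b)))) :
    IntegrableOn (marchaud F) (Ioo 0 b) := by
  have h1 : IntegrableOn (fun s => F s * s ^ (-(1 / 2) : ℝ)) (Ioo 0 b) :=
    (integrableOn_rpow_neg_half b).bdd_mul hF.aestronglyMeasurable (ae_of_all _ hM)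
  have h2 : IntegrableOn
      (fun s => ∫ u in Ioo 0 b, (F s - F u) * shiftKernel 0 (s - u)) (Ioo 0 b) :=
    hint.integral_prod_left
  have h3 : IntegrableOn (fun s => (√Real.pi)⁻¹ * (F s * s ^ (-(1 / 2) : ℝ) +
      1 / 2 * ∫ u in Ioo 0 b, (F s - F u) * shiftKernel 0 (s - u))) (Ioo 0 b) :=
    (h1.add (h2.const_mul (1 / 2))).const_mul _
  exact h3.congr_fun (fun s hs => (marchaud_eq_of_mem F hs).symm) measurableSet_Ioo

lemma setIntegral_marchaud (hF : Measurable F) (hM : ∀ s, |F s| ≤ M)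
    (hint : Integrable (fun z : ℝ × ℝ => (F z.1 - F z.2) * shiftKernel 0 (z.1 - z.2))
      ((volume.restrict (Ioo 0 b)).prod (volume.restrict (Ioo 0 b)))) {t : ℝ} (ht : t ≤ b) :
    ∫ s in Ioo 0 t, marchaud F s =
      (√Real.pi)⁻¹ * ∫ u in Ioo 0 t, F u * (t - u) ^ (-(1 / 2) : ℝ) := by
  have hint' : Integrable (fun z : ℝ × ℝ => (F z.1 - F z.2) * shiftKernel 0 (z.1 - z.2))
      ((volume.restrict (Ioo 0 t)).prod (volume.restrict (Ioo 0 t))) := by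
    refine hint.mono_measure ?_
    rw [Measure.prod_restrict, Measure.prod_restrict]
    exact Measure.restrict_mono
      (prod_mono (Ioo_subset_Ioo_right ht) (Ioo_subset_Ioo_right ht)) le_rfl
  have h1 : IntegrableOn (fun s => F s * s ^ (-(1 / 2) : ℝ)) (Ioo 0 t) :=
    (integrableOn_rpow_neg_half t).bdd_mul hF.aestronglyMeasurable (ae_of_all _ hM)
  have h2 : IntegrableOn
      (fun s => ∫ u in Ioo 0 t, (F s - F u) * shiftKernel 0 (s - u)) (Ioo 0 t) :=
    hint'.integral_prod_left
  rw [← integral_marchaud hF hM hint', integral_prod _ hint', ← integral_const_mul (1 / 2),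
    ← integral_add h1 (h2.const_mul _), ← integral_const_mul]
  exact setIntegral_congr_fun measurableSet_Ioo fun s hs => marchaud_eq_of_mem F hs

end Inversion

/-- The semigroup estimate at the end point b already makes (b - t)^(-1/2) times the half-integral
integrable; the weight is removed by the bounded factor (b - t)^(1/2). -/
lemma integrableOn_integral_mul_halfKernel {w : ℝ → ℝ} (hw : Integrable w) (a b : ℝ) :
    IntegrableOn (fun t => ∫ s, w s * halfKernel (t - s)) (Ioo a b) := by
  have h := (integrable_mul_halfKernel_mul_halfKernel hw b).integral_prod_left
  have h2 : IntegrableOn (fun t => (∫ s, w s * (halfKernel (b - t) * halfKernel (t - s))) *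
      (b - t) ^ (1 / 2 : ℝ)) (Ioo a b) := by
    refine h.integrableOn.mul_bdd (c := (b - a) ^ (1 / 2 : ℝ))
      ((measurable_const.sub measurable_id).pow_const _).aestronglyMeasurable ?_
    filter_upwards [ae_restrict_mem measurableSet_Ioo] with x hx
    have h0 : 0 ≤ b - x := by linarith [hx.2]
    rw [Real.norm_of_nonneg (by positivity)]
    exact Real.rpow_le_rpow h0 (by linarith [hx.1]) (by norm_num)
  refine h2.congr_fun (fun t ht => ?_) measurableSet_Ioo
  have h0 : 0 < b - t := by linarith [ht.2]
  simp only
  rw [← integral_mul_const]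
  congr 1; funext s
  have : halfKernel (b - t) * (b - t) ^ (1 / 2 : ℝ) = 1 := by
    rw [halfKernel, if_pos h0, ← Real.rpow_add h0]; norm_num
  linear_combination (w s * halfKernel (t - s)) * this

/-- Injectivity of the Abel transform. -/
lemma ae_eq_zero_of_integral_halfKernel_eq_zero {w : ℝ → ℝ} (hw : Integrable w) {b : ℝ}
    (h : ∀ t < b, ∫ s, w s * halfKernel (t - s) = 0) : ∀ᵐ t, t < b → w t = 0 := by
  -- A second half-integration turns the hypothesis into the vanishing of the primitive of w;
  -- Lebesgue differentiation then recovers w.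
  have h1 : ∀ t < b, ∫ s in Iio t, w s = 0 := by
    intro t ht
    have h2 := integral_halfKernel_mul_integral hw t
    have h3 : (fun u => halfKernel (t - u) * ∫ s, w s * halfKernel (u - s)) = fun _ => 0 := by
      funext u
      by_cases hu : u < t
      · rw [h u (by linarith), mul_zero]
      · rw [halfKernel, if_neg (by linarith), zero_mul]
    rw [h3, integral_zero] at h2
    exact (mul_eq_zero.1 h2.symm).resolve_left Real.pi_ne_zero
  filter_upwards [LocallyIntegrable.ae_hasDerivAt_integral hw.locallyIntegrable] with t ht htb
  have h4 : HasDerivAt (fun _ : ℝ => (0 : ℝ)) (w t) t := by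
    refine (ht (t - 1)).congr_of_eventuallyEq ?_
    filter_upwards [Iio_mem_nhds htb] with x hx
    rw [← intervalIntegral.integral_Iic_sub_Iic hw.integrableOn hw.integrableOn,
      integral_Iic_eq_integral_Iio, integral_Iic_eq_integral_Iio, h1 x hx,
      h1 (t - 1) (by linarith), sub_zero]
  exact h4.unique (hasDerivAt_const t 0)

/-- The Marchaud derivative inverts the half-integral. -/
theorem isLeftFracDeriv_marchaud {F : ℝ → ℝ} {M b : ℝ} (hF : Measurable F)
    (hM : ∀ s, |F s| ≤ M)
    (hint : Integrable (fun z : ℝ × ℝ => (F z.1 - F z.2) * shiftKernel 0 (z.1 - z.2))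
      ((volume.restrict (Ioo 0 b)).prod (volume.restrict (Ioo 0 b)))) :
    ∀ᵐ t ∂(volume.restrict (Ioo 0 b)), F t = leftFracIntegral (1 / 2) 0 (marchaud F) t := by
  have hφ := integrableOn_marchaud hF hM hint
  set φ₁ := (Ioo 0 b).indicator (marchaud F) with hφ₁
  have hφi : Integrable φ₁ := (integrable_indicator_iff measurableSet_Ioo).2 hφ
  set J : ℝ → ℝ := fun u => (√Real.pi)⁻¹ * ∫ s, φ₁ s * halfKernel (u - s) with hJ
  have hJi : IntegrableOn J (Ioo 0 b) :=
    (integrableOn_integral_mul_halfKernel hφi 0 b).const_mul _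
  have hFi : IntegrableOn F (Ioo 0 b) := integrable_of_measurable_of_le hF hM
  -- The defect of the inversion. Its half-integral vanishes: by the semigroup identity that of J is
  -- the primitive of `marchaud F`, which by `setIntegral_marchaud` is the half-integral of F.
  set w := (Ioo 0 b).indicator (fun u => J u - F u) with hw
  have hwi : Integrable w := (integrable_indicator_iff measurableSet_Ioo).2 (hJi.sub hFi)
  have hJ0 : ∀ u ≤ 0, J u = 0 := by
    intro u hu
    have : (fun s => φ₁ s * halfKernel (u - s)) = fun _ => 0 := by
      funext s
      by_cases hs : s ∈ Ioo 0 b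
      · rw [halfKernel, if_neg (by linarith [hs.1]), mul_zero]
      · rw [hφ₁, indicator_of_notMem hs, zero_mul]
    simp only [hJ, this, integral_zero, mul_zero]
  have hzero : ∀ t < b, ∫ s, w s * halfKernel (t - s) = 0 := by
    intro t ht
    have e1 : (fun s => w s * halfKernel (t - s)) = fun s => halfKernel (t - s) * J s -
        (Ioo 0 t).indicator (fun s => F s * (t - s) ^ (-(1 / 2) : ℝ)) s := by
      funext s
      simp only [hw, indicator, mem_Ioo, halfKernel]
      by_cases h0 : 0 < s
      · by_cases h1 : s < t
        · have h2 : s < b := h1.trans ht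
          simp only [h0, h1, h2, sub_pos, and_self, if_true]; ring
        · simp [h1]
      · simp [h0, hJ0 s (not_lt.1 h0)]
    have i1 : Integrable (fun s => halfKernel (t - s) * J s) := by
      have := (integrable_mul_halfKernel_mul_halfKernel hφi t).integral_prod_left.const_mul
        (√Real.pi)⁻¹
      refine this.congr (ae_of_all _ fun u => ?_)
      simp only [hJ]
      rw [mul_left_comm, ← integral_const_mul (halfKernel (t - u))]
      congr 2; funext s; ring
    have i2 : Integrable ((Ioo 0 t).indicator (fun s => F s * (t - s) ^ (-(1 / 2) : ℝ))) :=
      (integrable_indicator_iff measurableSet_Ioo).2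
        ((integrableOn_sub_rpow_neg_half t).bdd_mul hF.aestronglyMeasurable (ae_of_all _ hM))
    have e2 : ∫ s, halfKernel (t - s) * J s =
        (√Real.pi)⁻¹ * (Real.pi * ∫ s in Iio t, φ₁ s) := by
      rw [← integral_halfKernel_mul_integral hφi t, ← integral_const_mul]
      congr 1; funext s; simp only [hJ]; ring
    have e3 : ∫ s in Iio t, φ₁ s = ∫ s in Ioo 0 t, marchaud F s := by
      rw [hφ₁, setIntegral_indicator measurableSet_Ioo]
      congr 2
      ext x; simp only [mem_inter_iff, mem_Iio, mem_Ioo]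
      constructor
      · rintro ⟨h1, h2, h3⟩; exact ⟨h2, h1⟩
      · rintro ⟨h1, h2⟩; exact ⟨h2, h1, by linarith⟩
    rw [e1, integral_sub i1 i2, e2, e3, setIntegral_marchaud hF hM hint ht.le,
      integral_indicator measurableSet_Ioo]
    have : (√Real.pi)⁻¹ * (√Real.pi)⁻¹ * Real.pi = 1 := by
      rw [← mul_inv, Real.mul_self_sqrt Real.pi_pos.le, inv_mul_cancel₀ Real.pi_ne_zero]
    linear_combination (∫ u in Ioo 0 t, F u * (t - u) ^ (-(1 / 2) : ℝ)) * this
  rw [ae_restrict_iff' measurableSet_Ioo]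
  filter_upwards [ae_eq_zero_of_integral_halfKernel_eq_zero hwi hzero] with t ht htb
  have := ht htb.2
  rw [hw, indicator_of_mem htb, sub_eq_zero] at this
  rw [leftFracIntegral_half _ htb.2.le, ← this]

/-! ### Fractional integration by parts and difference quotients -/

lemma integrable_mul_halfKernel_mul_halfKernel' {w : ℝ → ℝ} (hw : Integrable w) (t : ℝ) :
    Integrable (fun z : ℝ × ℝ => w z.2 * (halfKernel (z.1 - t) * halfKernel (z.2 - z.1)))
      (volume.prod volume) := by
  have hm : AEStronglyMeasurable
      (fun z : ℝ × ℝ => w z.2 * (halfKernel (z.1 - t) * halfKernel (z.2 - z.1)))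
      (volume.prod volume) :=
    hw.aestronglyMeasurable.comp_snd.mul
      ((measurable_halfKernel.comp (measurable_fst.sub measurable_const)).mul
        (measurable_halfKernel.comp (measurable_snd.sub measurable_fst))).aestronglyMeasurable
  rw [integrable_prod_iff' hm]
  refine ⟨ae_of_all _ fun s => ?_, ?_⟩
  · simpa only [mul_comm (halfKernel (s - _))] using
      (integrable_halfKernel_mul t s).const_mul (w s)
  have : (fun s => ∫ u, ‖w s * (halfKernel (u - t) * halfKernel (s - u))‖) =
      fun s => (Ioi t).indicator (fun s => ‖w s‖ * Real.pi) s := by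
    funext s
    simp_rw [norm_mul, Real.norm_of_nonneg (halfKernel_nonneg _), mul_comm (halfKernel (_ - t))]
    rw [integral_const_mul, integral_halfKernel_mul]
    simp [indicator]
  simp only [this]
  exact (hw.norm.mul_const _).indicator measurableSet_Ioi

lemma integrable_halfKernel_mul_integral {w : ℝ → ℝ} (hw : Integrable w) (s : ℝ) :
    Integrable fun t => halfKernel (t - s) * ∫ u, w u * halfKernel (u - t) := by
  refine (integrable_mul_halfKernel_mul_halfKernel' hw s).integral_prod_left.congr
    (ae_of_all _ fun t => ?_)
  simp only
  rw [← integral_const_mul]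
  congr 1; funext u; ring

/-- Fractional integration by parts combined with the semigroup property. -/
lemma integral_integral_mul_halfKernel_mul {v w : ℝ → ℝ} (hv : Integrable v) (hw : Integrable w) :
    ∫ t, (∫ s, v s * halfKernel (t - s)) * (∫ u, w u * halfKernel (u - t)) =
      Real.pi * ∫ s, v s * ∫ u in Ioi s, w u := by
  set h : ℝ → ℝ := fun t => ∫ u, w u * halfKernel (u - t) with hh
  have hmh : AEStronglyMeasurable h volume := by
    have : AEStronglyMeasurable (fun z : ℝ × ℝ => w z.2 * halfKernel (z.2 - z.1))
        (volume.prod volume) :=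
      hw.aestronglyMeasurable.comp_snd.mul
        (measurable_halfKernel.comp (measurable_snd.sub measurable_fst)).aestronglyMeasurable
    exact this.integral_prod_right'
  have hm : AEStronglyMeasurable (fun z : ℝ × ℝ => v z.2 * (halfKernel (z.1 - z.2) * h z.1))
      (volume.prod volume) :=
    hv.aestronglyMeasurable.comp_snd.mul
      ((measurable_halfKernel.comp (measurable_fst.sub measurable_snd)).aestronglyMeasurable.mul
        hmh.comp_fst)
  -- The bound is uniform in s, so integrability of v alone justifies Fubini.
  have hb : ∀ s, ∫ t, ‖halfKernel (t - s) * h t‖ ≤ Real.pi * ∫ u, ‖w u‖ := by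
    intro s
    calc ∫ t, ‖halfKernel (t - s) * h t‖
        ≤ ∫ t, halfKernel (t - s) * ∫ u, ‖w u‖ * halfKernel (u - t) := by
          refine integral_mono (integrable_halfKernel_mul_integral hw s).norm
            (integrable_halfKernel_mul_integral hw.norm s) fun t => ?_
          simp only
          rw [norm_mul, Real.norm_of_nonneg (halfKernel_nonneg _)]
          refine mul_le_mul_of_nonneg_left ?_ (halfKernel_nonneg _)
          refine (norm_integral_le_integral_norm _).trans_eq ?_
          simp_rw [norm_mul, Real.norm_of_nonneg (halfKernel_nonneg _)]
      _ = Real.pi * ∫ u in Ioi s, ‖w u‖ := integral_halfKernel_mul_integral' hw.norm s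
      _ ≤ Real.pi * ∫ u, ‖w u‖ := mul_le_mul_of_nonneg_left
          (setIntegral_le_integral hw.norm (ae_of_all _ fun _ => norm_nonneg _)) Real.pi_pos.le
  have hi : Integrable (fun z : ℝ × ℝ => v z.2 * (halfKernel (z.1 - z.2) * h z.1))
      (volume.prod volume) := by
    rw [integrable_prod_iff' hm]
    refine ⟨ae_of_all _ fun s => (integrable_halfKernel_mul_integral hw s).const_mul (v s), ?_⟩
    refine (hv.norm.mul_const (Real.pi * ∫ u, ‖w u‖)).mono'
      hm.prod_swap.norm.integral_prod_right' (ae_of_all _ fun s => ?_)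
    rw [Real.norm_of_nonneg (integral_nonneg fun _ => norm_nonneg _)]
    simp only [norm_mul (v s)]
    rw [integral_const_mul]
    exact mul_le_mul_of_nonneg_left (hb s) (norm_nonneg _)
  calc _ = ∫ t, ∫ s, v s * (halfKernel (t - s) * h t) := by
        congr 1; funext t
        rw [← integral_mul_const]
        congr 1; funext s; ring
    _ = ∫ s, ∫ t, v s * (halfKernel (t - s) * h t) :=
        integral_integral_swap (f := fun t s => v s * (halfKernel (t - s) * h t)) hi
    _ = ∫ s, Real.pi * (v s * ∫ u in Ioi s, w u) := by
        congr 1; funext s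
        rw [integral_const_mul, integral_halfKernel_mul_integral' hw]; ring
    _ = _ := integral_const_mul _ _

/-- Half-integration commutes with translation, so integration by parts turns the pairing into that
of v with -ε⁻¹ ∫_s^{s+ε} w. These means converge almost everywhere to -w and are bounded by M;
domination by M|v| uses exactly the L¹–L^∞ duality. -/
lemma tendsto_integral_mul_diffQuot {v w : ℝ → ℝ} (hv : Integrable v) (hw : Integrable w)
    {M : ℝ} (hM : ∀ x, |w x| ≤ M) (hwk : ∀ t, Integrable fun u => w u * halfKernel (u - t)) :
    Tendsto (fun ε : ℝ => ∫ t, ((√Real.pi)⁻¹ * ∫ s, v s * halfKernel (t - s)) *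
        ((((√Real.pi)⁻¹ * ∫ u, w u * halfKernel (u - (t + ε))) -
          (√Real.pi)⁻¹ * ∫ u, w u * halfKernel (u - t)) / ε)) (𝓝[>] 0)
      (𝓝 (-∫ s, v s * w s)) := by
  have e : ∀ ε : ℝ, 0 < ε → ∫ t, ((√Real.pi)⁻¹ * ∫ s, v s * halfKernel (t - s)) *
        ((((√Real.pi)⁻¹ * ∫ u, w u * halfKernel (u - (t + ε))) -
          (√Real.pi)⁻¹ * ∫ u, w u * halfKernel (u - t)) / ε) =
      ∫ s, v s * (-(ε⁻¹ * ∫ u in s..(s + ε), w u)) := by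
    intro ε hε
    have hwε : Integrable fun u => w (u + ε) := hw.comp_add_right ε
    have h1 : ∀ t, (∫ u, w u * halfKernel (u - (t + ε))) - ∫ u, w u * halfKernel (u - t) =
        ∫ u, (w (u + ε) - w u) * halfKernel (u - t) := by
      intro t
      have h2 : Integrable fun u => w (u + ε) * halfKernel (u - t) := by
        refine ((hwk (t + ε)).comp_add_right ε).congr (ae_of_all _ fun u => ?_)
        simp only
        congr 2; ring
      simp_rw [sub_mul]
      rw [integral_sub h2 (hwk t), ← integral_add_right_eq_self _ ε]
      congr 2; funext u
      congr 2; ring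
    have h3 : ∀ s, ∫ u in Ioi s, (w (u + ε) - w u) = -∫ u in s..(s + ε), w u := by
      intro s
      have hshift : ∫ u in Ioi s, w (u + ε) = ∫ u in Ioi (s + ε), w u := by
        have := (measurePreserving_add_right volume ε).setIntegral_preimage_emb
          (measurableEmbedding_addRight ε) w (Ioi (s + ε))
        rw [← this]
        congr 2
        ext x; simp
      rw [integral_sub hwε.integrableOn hw.integrableOn, hshift,
        intervalIntegral.integral_of_le (by linarith), ← Ioc_union_Ioi_eq_Ioi
          (a := s) (b := s + ε) (by linarith), setIntegral_union (Ioc_disjoint_Ioi le_rfl)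
          measurableSet_Ioi hw.integrableOn hw.integrableOn]
      ring
    calc _ = ∫ t, (Real.pi⁻¹ * ε⁻¹) * ((∫ s, v s * halfKernel (t - s)) *
          ∫ u, (w (u + ε) - w u) * halfKernel (u - t)) := by
          congr 1; funext t
          rw [← mul_sub, h1]
          have : (√Real.pi)⁻¹ * (√Real.pi)⁻¹ = Real.pi⁻¹ := by
            rw [← mul_inv, Real.mul_self_sqrt Real.pi_pos.le]
          rw [← this]; ring
      _ = _ := by
          have hsub := integral_integral_mul_halfKernel_mul hv (hwε.sub hw)
          simp only [Pi.sub_apply] at hsub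
          rw [integral_const_mul, hsub,
            mul_assoc, ← mul_assoc ε⁻¹, mul_comm ε⁻¹, mul_assoc, inv_mul_cancel_left₀
            Real.pi_ne_zero, ← integral_const_mul]
          congr 1; funext s
          rw [h3 s]; ring
  rw [← integral_neg]
  have hlim : Tendsto (fun ε : ℝ => ∫ s, v s * (-(ε⁻¹ * ∫ u in s..(s + ε), w u))) (𝓝[>] 0)
      (𝓝 (∫ s, -(v s * w s))) := by
    refine tendsto_integral_filter_of_dominated_convergence (fun s => ‖v s‖ * M) ?_ ?_
      (hv.norm.mul_const M) ?_
    · refine Eventually.of_forall fun ε => hv.aestronglyMeasurable.mul ?_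
      refine (Continuous.const_mul ?_ _).neg.aestronglyMeasurable
      have : (fun s => ∫ u in s..(s + ε), w u) =
          fun s => (∫ u in (0 : ℝ)..(s + ε), w u) - ∫ u in (0 : ℝ)..s, w u := by
        funext s
        rw [intervalIntegral.integral_interval_sub_left] <;> exact hw.intervalIntegrable
      rw [this]
      have hc := intervalIntegral.continuous_primitive (fun _ _ => hw.intervalIntegrable) 0
        (μ := volume) (f := w)
      exact (hc.comp (continuous_add_const ε)).sub hc
    · filter_upwards [self_mem_nhdsWithin] with ε hε
      have hε' : 0 < ε := hε
      refine ae_of_all _ fun s => ?_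
      rw [norm_mul, norm_neg, norm_mul]
      refine mul_le_mul_of_nonneg_left ?_ (norm_nonneg _)
      have := intervalIntegral.norm_integral_le_of_norm_le_const (a := s) (b := s + ε) (f := w)
        (C := M) fun x _ => hM x
      rw [add_sub_cancel_left, abs_of_pos hε'] at this
      rw [Real.norm_of_nonneg (by positivity), inv_mul_le_iff₀ hε', mul_comm ε]
      exact this
    · filter_upwards [LocallyIntegrable.ae_hasDerivAt_integral hw.locallyIntegrable] with s hs
      have h1 := (hs s).tendsto_slope_zero_right
      simp only [smul_eq_mul, intervalIntegral.integral_same, sub_zero] at h1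
      simpa using (h1.const_mul (v s)).neg
  refine hlim.congr' ?_
  filter_upwards [self_mem_nhdsWithin] with ε hε
  exact (e ε hε).symm

lemma integrable_indicator_mul_halfKernel {ψ : ℝ → ℝ} {b M : ℝ}
    (hψ : AEStronglyMeasurable ψ (volume.restrict (Ioo 0 b))) (hM : ∀ x ∈ Ioo 0 b, |ψ x| ≤ M)
    (t : ℝ) : Integrable fun u => (Ioo 0 b).indicator ψ u * halfKernel (u - t) := by
  have h1 : IntegrableOn (fun u => halfKernel (u - t)) (Ioo 0 b) := by
    have h2 := ((integrable_indicator_iff measurableSet_Ioc).2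
      (integrableOn_halfKernel (-t) (b - t))).comp_sub_right t
    refine (h2.integrableOn (s := Ioo 0 b)).congr_fun (fun u hu => ?_) measurableSet_Ioo
    simp only
    rw [indicator_of_mem (show u - t ∈ Ioc (-t) (b - t) from
      ⟨by linarith [hu.1], by linarith [hu.2]⟩)]
  have h3 : IntegrableOn (fun u => ψ u * halfKernel (u - t)) (Ioo 0 b) :=
    h1.bdd_mul (c := M) hψ ((ae_restrict_mem measurableSet_Ioo).mono hM)
  refine ((integrable_indicator_iff measurableSet_Ioo).2 h3).congr (ae_of_all _ fun u => ?_)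
  simp only [indicator]
  split_ifs <;> simp

/-- The bilinear form of the half-derivatives as a limit of forward difference integrals. -/
lemma tendsto_setIntegral_mul_diffQuot {F G φ ψ : ℝ → ℝ} {b M : ℝ}
    (hφ : IntegrableOn φ (Ioo 0 b))
    (hψ : AEStronglyMeasurable ψ (volume.restrict (Ioo 0 b))) (hM : ∀ x ∈ Ioo 0 b, |ψ x| ≤ M)
    (hF : ∀ᵐ t ∂(volume.restrict (Ioo 0 b)), F t = leftFracIntegral (1 / 2) 0 φ t)
    (hG : ∀ᵐ t ∂(volume.restrict (Ioo 0 b)), G t = rightFracIntegral (1 / 2) b ψ t)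
    (hG0 : ∀ t, b ≤ t → G t = 0) :
    Tendsto (fun ε : ℝ => ∫ t in Ioo 0 b, F t * ((G (t + ε) - G t) / ε)) (𝓝[>] 0)
      (𝓝 (-∫ t in Ioo 0 b, φ t * ψ t)) := by
  have hM' : ∀ x, |(Ioo 0 b).indicator ψ x| ≤ |M| := by
    intro x
    by_cases hx : x ∈ Ioo 0 b
    · rw [indicator_of_mem hx]; exact (hM x hx).trans (le_abs_self M)
    · rw [indicator_of_notMem hx, abs_zero]; exact abs_nonneg _
  have hψi : IntegrableOn ψ (Ioo 0 b) :=
    Integrable.of_bound hψ M ((ae_restrict_mem measurableSet_Ioo).mono hM)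
  have hlim := tendsto_integral_mul_diffQuot
    ((integrable_indicator_iff measurableSet_Ioo).2 hφ)
    ((integrable_indicator_iff measurableSet_Ioo).2 hψi) hM'
    (integrable_indicator_mul_halfKernel hψ hM)
  have e0 : ∫ s, (Ioo 0 b).indicator φ s * (Ioo 0 b).indicator ψ s =
      ∫ t in Ioo 0 b, φ t * ψ t := by
    rw [← integral_indicator measurableSet_Ioo]
    congr 1; funext s
    simp only [indicator]; split_ifs <;> simp
  rw [e0] at hlim
  refine hlim.congr' ?_
  filter_upwards [self_mem_nhdsWithin] with ε hε
  have hε' : 0 < ε := hε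
  set Φ : ℝ → ℝ := fun t => (√Real.pi)⁻¹ * ∫ s, (Ioo 0 b).indicator φ s * halfKernel (t - s)
  set Ψ : ℝ → ℝ := fun t => (√Real.pi)⁻¹ * ∫ s, (Ioo 0 b).indicator ψ s * halfKernel (s - t)
    with hΨ
  have hΦ0 : ∀ t ≤ 0, Φ t = 0 := by
    intro t ht
    have : (fun s => (Ioo 0 b).indicator φ s * halfKernel (t - s)) = fun _ => 0 := by
      funext s
      by_cases hs : s ∈ Ioo 0 b
      · rw [halfKernel, if_neg (by linarith [hs.1]), mul_zero]
      · rw [indicator_of_notMem hs, zero_mul]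
    simp only [Φ, this, integral_zero, mul_zero]
  have hΨ0 : ∀ t, b ≤ t → Ψ t = 0 := by
    intro t ht
    have : (fun s => (Ioo 0 b).indicator ψ s * halfKernel (s - t)) = fun _ => 0 := by
      funext s
      by_cases hs : s ∈ Ioo 0 b
      · rw [halfKernel, if_neg (by linarith [hs.2]), mul_zero]
      · rw [indicator_of_notMem hs, zero_mul]
    simp only [Ψ, this, integral_zero, mul_zero]
  -- The representation is given only on (0, b), but t + ε may pass b; beyond b both sides vanish.
  have hGΨ : ∀ᵐ t, 0 < t → G t = Ψ t := by
    rw [ae_restrict_iff' measurableSet_Ioo] at hG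
    filter_upwards [hG] with t ht h0
    by_cases h1 : t < b
    · rw [ht ⟨h0, h1⟩, rightFracIntegral_half _ h0.le]
    · rw [hG0 t (not_lt.1 h1), hΨ0 t (not_lt.1 h1)]
  have hGε : ∀ᵐ t, 0 < t + ε → G (t + ε) = Ψ (t + ε) :=
    (measurePreserving_add_right volume ε).quasiMeasurePreserving.ae hGΨ
  rw [← integral_indicator measurableSet_Ioo]
  refine integral_congr_ae ?_
  rw [ae_restrict_iff' measurableSet_Ioo] at hF
  filter_upwards [hF, hGΨ, hGε] with t h1 h2 h3
  change Φ t * ((Ψ (t + ε) - Ψ t) / ε) = _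
  by_cases ht0 : 0 < t
  · by_cases htb : t < b
    · rw [indicator_of_mem (show t ∈ Ioo 0 b from ⟨ht0, htb⟩), h1 ⟨ht0, htb⟩, h2 ht0, h3 (by linarith),
        leftFracIntegral_half _ htb.le]
    · rw [indicator_of_notMem (fun h => htb h.2), hΨ0 t (by linarith), hΨ0 (t + ε) (by linarith)]
      simp
  · rw [indicator_of_notMem (fun h => ht0 h.1), hΦ0 t (by linarith), zero_mul]

/-! ### Marchaud derivatives from moduli of continuity -/

/-- A modulus of continuity, integrable against `v ^ (-3/2)`, gives the integrability that is
required for the Marchaud derivative. -/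
lemma integrable_marchaud_of_modulus {F : ℝ → ℝ} {H : ℝ → ℝ → ℝ} {b : ℝ} (hF : Measurable F)
    (hH : ∀ s ∈ Ioo 0 b, ∀ u ∈ Ioo 0 s, |F s - F u| ≤ H s (s - u))
    (hfin : ∫⁻ s in Ioo 0 b, ∫⁻ v in Ioo 0 b,
      ENNReal.ofReal (H s v) * ENNReal.ofReal (v ^ (-(3 / 2) : ℝ)) < ∞) :
    Integrable (fun z : ℝ × ℝ => (F z.1 - F z.2) * shiftKernel 0 (z.1 - z.2))
      ((volume.restrict (Ioo 0 b)).prod (volume.restrict (Ioo 0 b))) := by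
  have hm : Measurable fun z : ℝ × ℝ => (F z.1 - F z.2) * shiftKernel 0 (z.1 - z.2) :=
    ((hF.comp measurable_fst).sub (hF.comp measurable_snd)).mul
      ((measurable_shiftKernel 0).comp (measurable_fst.sub measurable_snd))
  refine ⟨hm.aestronglyMeasurable, ?_⟩
  rw [HasFiniteIntegral, lintegral_prod _ hm.enorm.aemeasurable]
  refine lt_of_le_of_lt (setLIntegral_mono' measurableSet_Ioo fun s hs => ?_) hfin
  rw [← lintegral_indicator measurableSet_Ioo, ← lintegral_indicator measurableSet_Ioo,
    ← lintegral_sub_left_eq_self _ s]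
  refine lintegral_mono fun v => ?_
  simp only [indicator, mem_Ioo]
  by_cases h : 0 < s - v ∧ s - v < b
  · rw [if_pos h, sub_sub_cancel, shiftKernel]
    by_cases hv : 0 < v
    · have hvb : v < b := by linarith [hs.2]
      have := hH s hs (s - v) ⟨h.1, by linarith⟩
      rw [sub_sub_cancel] at this
      rw [if_pos hv, if_pos ⟨hv, hvb⟩, add_zero, enorm_mul, Real.enorm_eq_ofReal_abs,
        Real.enorm_of_nonneg (by positivity)]
      gcongr
    · simp [hv]
  · rw [if_neg h]; exact zero_le

section Holder

variable {F : ℝ → ℝ} {K α b : ℝ}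

lemma integrableOn_rpow_sub_three_half (hα : 1 / 2 < α) (c : ℝ) :
    IntegrableOn (fun v : ℝ => v ^ (α - 3 / 2)) (Ioo 0 c) := by
  rcases le_or_gt c 0 with hc | hc
  · simp [Ioo_eq_empty (not_lt.2 hc)]
  exact ((intervalIntegral.intervalIntegrable_rpow' (a := 0) (b := c)
    (r := α - 3 / 2) (by linarith)).1).mono_set Ioo_subset_Ioc_self

lemma lintegral_rpow_mul_rpow_lt_top (hα : 1 / 2 < α) (hK : 0 ≤ K) :
    ∫⁻ v in Ioo 0 b, ENNReal.ofReal (K * v ^ α) * ENNReal.ofReal (v ^ (-(3 / 2) : ℝ)) < ∞ := by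
  have h := ((integrableOn_rpow_sub_three_half hα b).const_mul K).lintegral_lt_top
  refine lt_of_le_of_lt (setLIntegral_mono' measurableSet_Ioo fun v hv => ?_) h
  have hv0 : 0 < v := hv.1
  rw [← ENNReal.ofReal_mul (by positivity), mul_assoc, ← Real.rpow_add hv0]
  exact le_of_eq (by ring_nf)

lemma integrable_marchaud_of_holder (hα : 1 / 2 < α) (hK : 0 ≤ K) (hF : Measurable F)
    (hH : ∀ s u, u ≤ s → |F s - F u| ≤ K * (s - u) ^ α) :
    Integrable (fun z : ℝ × ℝ => (F z.1 - F z.2) * shiftKernel 0 (z.1 - z.2))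
      ((volume.restrict (Ioo 0 b)).prod (volume.restrict (Ioo 0 b))) := by
  refine integrable_marchaud_of_modulus (H := fun _ v => K * v ^ α) hF
    (fun s _ u hu => hH s u hu.2.le) ?_
  rw [lintegral_const]
  exact ENNReal.mul_lt_top (lintegral_rpow_mul_rpow_lt_top hα hK) (by simp)

/-- F(0) = 0 bounds the boundary term by K s^(α - 1/2), and α > 1/2 makes v^(α - 3/2) integrable at
0. -/
lemma exists_abs_marchaud_le (hα : 1 / 2 < α) (hK : 0 ≤ K) (hF0 : F 0 = 0)
    (hH : ∀ s u, u ≤ s → |F s - F u| ≤ K * (s - u) ^ α) (b : ℝ) :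
    ∃ M, ∀ s ∈ Ioo 0 b, |marchaud F s| ≤ M := by
  refine ⟨(√Real.pi)⁻¹ * (K * b ^ (α - 1 / 2) +
    1 / 2 * ∫ v in Ioo 0 b, K * v ^ (α - 3 / 2)), fun s hs => ?_⟩
  have hs0 : 0 < s := hs.1
  have h1 : |F s * s ^ (-(1 / 2) : ℝ)| ≤ K * b ^ (α - 1 / 2) := by
    have := hH s 0 hs0.le
    rw [hF0, sub_zero, sub_zero] at this
    rw [abs_mul, abs_of_nonneg (a := s ^ (-(1 / 2) : ℝ)) (by positivity)]
    calc _ ≤ K * s ^ α * s ^ (-(1 / 2) : ℝ) := by gcongr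
      _ = K * s ^ (α - 1 / 2) := by
        rw [mul_assoc, ← Real.rpow_add hs0]; ring_nf
      _ ≤ _ := by
        refine mul_le_mul_of_nonneg_left (Real.rpow_le_rpow hs0.le hs.2.le (by linarith)) hK
  have hi : IntegrableOn (fun u => K * (s - u) ^ (α - 3 / 2)) (Ioo 0 s) := by
    rw [← integrable_indicator_iff measurableSet_Ioo]
    have := ((integrable_indicator_iff measurableSet_Ioo).2
      ((integrableOn_rpow_sub_three_half hα s).const_mul K)).comp_sub_left s
    refine this.congr (ae_of_all _ fun u => ?_)
    simp only [indicator, mem_Ioo]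
    congr 1
    simp only [sub_pos, sub_lt_self_iff, eq_iff_iff]
    tauto
  have h2 : |∫ u in Ioo 0 s, (F s - F u) * (s - u) ^ (-(3 / 2) : ℝ)| ≤
      ∫ v in Ioo 0 b, K * v ^ (α - 3 / 2) := by
    calc _ ≤ ∫ u in Ioo 0 s, K * (s - u) ^ (α - 3 / 2) := by
          rw [← Real.norm_eq_abs]
          refine norm_integral_le_of_norm_le hi ?_
          filter_upwards [ae_restrict_mem measurableSet_Ioo] with u hu
          have h3 : 0 < s - u := by linarith [hu.2]
          rw [norm_mul, Real.norm_of_nonneg (r := (s - u) ^ (-(3 / 2) : ℝ)) (by positivity)]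
          calc _ ≤ K * (s - u) ^ α * (s - u) ^ (-(3 / 2) : ℝ) := by
                gcongr; exact hH s u hu.2.le
            _ = _ := by rw [mul_assoc, ← Real.rpow_add h3]; ring_nf
      _ = ∫ v in Ioo 0 s, K * v ^ (α - 3 / 2) := by
          rw [← integral_indicator measurableSet_Ioo, ← integral_indicator measurableSet_Ioo,
            ← integral_sub_left_eq_self _ volume s]
          congr 1; funext x
          simp only [indicator, mem_Ioo, sub_sub_cancel]
          congr 1
          simp only [sub_pos, sub_lt_self_iff, eq_iff_iff]
          tauto
      _ ≤ _ := by
          refine setIntegral_mono_set ((integrableOn_rpow_sub_three_half hα b).const_mul K) ?_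
            (Ioo_subset_Ioo_right hs.2.le).eventuallyLE
          filter_upwards [ae_restrict_mem measurableSet_Ioo] with v hv
          have := hv.1
          simp only [Pi.zero_apply]
          positivity
  rw [marchaud, abs_mul, abs_of_nonneg (a := (√Real.pi)⁻¹) (by positivity)]
  refine mul_le_mul_of_nonneg_left ((abs_add_le _ _).trans (add_le_add h1 ?_)) (by positivity)
  rw [abs_mul, abs_of_pos (by norm_num : (0 : ℝ) < 1 / 2)]
  exact mul_le_mul_of_nonneg_left h2 (by norm_num)

/-- A Hölder function of order `> 1/2` that vanishes at `b` has a bounded right-sided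
half-derivative. -/
lemma exists_rightFracDeriv_of_holder {G : ℝ → ℝ} {M : ℝ} (hα : 1 / 2 < α) (hK : 0 ≤ K)
    (hG : Measurable G) (hM : ∀ s, |G s| ≤ M) (hGb : G b = 0)
    (hH : ∀ s u, u ≤ s → |G s - G u| ≤ K * (s - u) ^ α) :
    ∃ (ψ : ℝ → ℝ) (C : ℝ), AEStronglyMeasurable ψ (volume.restrict (Ioo 0 b)) ∧
      (∀ x ∈ Ioo 0 b, |ψ x| ≤ C) ∧
      ∀ᵐ t ∂(volume.restrict (Ioo 0 b)), G t = rightFracIntegral (1 / 2) b ψ t := by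
  -- Reflection turns vanishing at b into vanishing at 0, the base point of `marchaud`.
  set R : ℝ → ℝ := fun s => G (b - s) with hR
  have hRm : Measurable R := hG.comp (measurable_const.sub measurable_id)
  have hRH : ∀ s u, u ≤ s → |R s - R u| ≤ K * (s - u) ^ α := fun s u hus => by
    have := hH (b - u) (b - s) (by linarith)
    rw [abs_sub_comm]
    simpa only [hR, sub_sub_sub_cancel_left] using this
  have hRM : ∀ s, |R s| ≤ M := fun s => hM _
  have hint := integrable_marchaud_of_holder (b := b) hα hK hRm hRH
  obtain ⟨C, hC⟩ := exists_abs_marchaud_le hα hK (by simp [hR, hGb]) hRH b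
  have hmp := Measure.measurePreserving_sub_left (volume : Measure ℝ) b
  have hpre : (fun x => b - x) ⁻¹' Ioo 0 b = Ioo 0 b := by
    ext x; simp only [mem_preimage, mem_Ioo, sub_pos, sub_lt_self_iff]; tauto
  have hmp' : MeasurePreserving (fun x => b - x) (volume.restrict (Ioo 0 b))
      (volume.restrict (Ioo 0 b)) := by
    have := hmp.restrict_preimage (s := Ioo 0 b) measurableSet_Ioo
    rwa [hpre] at this
  refine ⟨fun t => marchaud R (b - t), C, ?_, ?_, ?_⟩
  · exact (integrableOn_marchaud hRm hRM hint).aestronglyMeasurable.comp_measurePreserving hmp'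
  · intro x hx
    exact hC (b - x) ⟨by linarith [hx.2], by linarith [hx.1]⟩
  · filter_upwards [hmp'.quasiMeasurePreserving.ae (isLeftFracDeriv_marchaud hRm hRM hint)]
      with t ht
    rw [rightFracIntegral_eq_leftFracIntegral]
    simpa [hR] using ht

end Holder

/-! ### The chain rule along one path -/

/-- First-order Taylor estimate for an absolutely continuous function, the variation of whose
derivative is controlled by a monotone function. -/
lemma abs_sub_sub_mul_le {f f' V : ℝ → ℝ} (hf : ∀ a b : ℝ, AbsolutelyContinuousOnInterval f a b)
    (hff' : ∀ᵐ x : ℝ, HasDerivAt f (f' x) x) (hV : Monotone V)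
    (hfV : ∀ x y, x ≤ y → |f' y - f' x| ≤ V y - V x) {x y δ : ℝ} (h : |y - x| ≤ δ) :
    |f y - f x - f' x * (y - x)| ≤ |y - x| * (V (x + δ) - V (x - δ)) := by
  have hae : ∀ᵐ z : ℝ, z ∈ uIoc x y → deriv f z = f' z := hff'.mono fun z hz _ => hz.deriv
  have hint : IntervalIntegrable f' volume x y := by
    refine (hf x y).intervalIntegrable_deriv.congr_ae ?_
    exact (ae_restrict_iff' measurableSet_uIoc).2 hae
  have h1 : ∫ z in x..y, f' z = f y - f x := by
    rw [← (hf x y).integral_deriv_eq_sub]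
    exact (intervalIntegral.integral_congr_ae hae).symm
  -- Only the value `f' x` enters, so the estimate holds at every x, including points where f is not
  -- differentiable.
  have h2 : f y - f x - f' x * (y - x) = ∫ z in x..y, (f' z - f' x) := by
    rw [intervalIntegral.integral_sub hint intervalIntegrable_const, h1,
      intervalIntegral.integral_const, smul_eq_mul, mul_comm]
  rw [h2, mul_comm, ← Real.norm_eq_abs]
  refine intervalIntegral.norm_integral_le_of_norm_le_const fun z hz => ?_
  have hz' : |z - x| ≤ δ := (abs_sub_left_of_mem_uIcc (uIoc_subset_uIcc hz)).trans h
  rw [abs_le] at hz'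
  rcases le_total x z with hxz | hxz
  · exact (hfV x z hxz).trans (sub_le_sub (hV (by linarith)) (hV (by linarith)))
  · rw [Real.norm_eq_abs, abs_sub_comm]
    exact (hfV z x hxz).trans (sub_le_sub (hV (by linarith)) (hV (by linarith)))

/-- The shifted and unshifted integrals overlap, leaving the mean of c over [b, b + ε] minus that
over [0, ε]. -/
lemma tendsto_setIntegral_diffQuot {c : ℝ → ℝ} (hc : Continuous c) {b : ℝ} (hb : 0 ≤ b) :
    Tendsto (fun ε : ℝ => ∫ t in Ioo 0 b, (c (t + ε) - c t) / ε) (𝓝[>] 0) (𝓝 (c b - c 0)) := by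
  have hi : ∀ x y, IntervalIntegrable c volume x y := fun x y => hc.intervalIntegrable x y
  have e : ∀ ε : ℝ, ∫ t in Ioo 0 b, (c (t + ε) - c t) / ε =
      ε⁻¹ * (∫ t in b..(b + ε), c t) - ε⁻¹ * ∫ t in (0 : ℝ)..(0 + ε), c t := by
    intro ε
    rw [← integral_Ioc_eq_integral_Ioo, ← intervalIntegral.integral_of_le hb,
      intervalIntegral.integral_div, intervalIntegral.integral_sub
        (Continuous.intervalIntegrable (by fun_prop) _ _) (hi _ _),
      intervalIntegral.integral_comp_add_right c ε, ← mul_sub,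
      intervalIntegral.integral_interval_sub_interval_comm (hi _ _) (hi _ _) (hi _ _),
      intervalIntegral.integral_symm b, intervalIntegral.integral_symm 0, div_eq_inv_mul]
    ring
  have d : ∀ a, Tendsto (fun ε : ℝ => ε⁻¹ * ∫ t in a..(a + ε), c t) (𝓝[>] 0) (𝓝 (c a)) := by
    intro a
    have := (hc.integral_hasStrictDerivAt a a).hasDerivAt.tendsto_slope_zero_right
    simpa using this
  simp_rw [e]
  exact (d b).sub (d 0)

/-- A Chebyshev-type bound: keep only v in (ε, 2ε), where monotonicity bounds the integrand below by
its value with ε in the modulus and 2ε in the power. If the right side is finite, the modulus at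
scale ε thus has time integral O(ε^(1/2)). -/
lemma lintegral_modulus_le {m : ℝ → ℝ → ℝ} (hm : ∀ s, Monotone (m s)) {α K b ε : ℝ}
    (hα : 0 ≤ α) (hK : 0 ≤ K) (hε : 0 < ε) (hεb : 2 * ε ≤ b) :
    (∫⁻ s in Ioo 0 b, ENNReal.ofReal (m s (K * ε ^ α))) *
        ENNReal.ofReal ((2 * ε) ^ (-(3 / 2) : ℝ) * ε) ≤
      ∫⁻ s in Ioo 0 b, ∫⁻ v in Ioo 0 b,
        ENNReal.ofReal (m s (K * v ^ α)) * ENNReal.ofReal (v ^ (-(3 / 2) : ℝ)) := by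
  rw [← lintegral_mul_const' _ _ ENNReal.ofReal_ne_top]
  refine lintegral_mono fun s => ?_
  calc ENNReal.ofReal (m s (K * ε ^ α)) * ENNReal.ofReal ((2 * ε) ^ (-(3 / 2) : ℝ) * ε)
      = ∫⁻ v in Ioo ε (2 * ε),
          ENNReal.ofReal (m s (K * ε ^ α)) * ENNReal.ofReal ((2 * ε) ^ (-(3 / 2) : ℝ)) := by
        rw [lintegral_const, Measure.restrict_apply_univ, Real.volume_Ioo, mul_assoc,
          ENNReal.ofReal_mul (by positivity : 0 ≤ (2 * ε) ^ (-(3 / 2) : ℝ)),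
          show 2 * ε - ε = ε by ring]
    _ ≤ ∫⁻ v in Ioo ε (2 * ε),
          ENNReal.ofReal (m s (K * v ^ α)) * ENNReal.ofReal (v ^ (-(3 / 2) : ℝ)) := by
        refine setLIntegral_mono' measurableSet_Ioo fun v hv => ?_
        have hv0 : 0 < v := hε.trans hv.1
        refine mul_le_mul' (ENNReal.ofReal_le_ofReal (hm s ?_)) (ENNReal.ofReal_le_ofReal ?_)
        · exact mul_le_mul_of_nonneg_left (Real.rpow_le_rpow hε.le hv.1.le hα) hK
        · exact Real.rpow_le_rpow_of_nonpos hv0 hv.2.le (by norm_num)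
    _ ≤ _ := lintegral_mono_set (Ioo_subset_Ioo hε.le hεb)

/-- The chain rule for the fractional integral along a single Hölder path. -/
theorem hasZSIntegral_of_modulus {G f f' V : ℝ → ℝ} {b K α Fa : ℝ} (hb : 0 < b)
    (hα : 1 / 2 < α) (hK : 0 ≤ K)
    (hG : ∀ s ∈ Icc 0 b, ∀ u ∈ Icc 0 b, |G s - G u| ≤ K * |s - u| ^ α)
    (hV : Monotone V) (hfV : ∀ x y, x ≤ y → |f' y - f' x| ≤ V y - V x) (hf'm : Measurable f')
    (hfc : Continuous f)
    (hT : ∀ x y δ, |y - x| ≤ δ → |f y - f x - f' x * (y - x)| ≤ |y - x| * (V (x + δ) - V (x - δ)))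
    (hfin : ∫⁻ s in Ioo 0 b, ∫⁻ v in Ioo 0 b,
      ENNReal.ofReal (V (G s + K * v ^ α) - V (G s - K * v ^ α)) *
        ENNReal.ofReal (v ^ (-(3 / 2) : ℝ)) < ∞)
    (hlim : Tendsto (fun s => f' (G s)) (𝓝[>] 0) (𝓝 Fa)) :
    HasZSIntegral (fun s => f' (G s)) G 0 b (f (G b) - f (G 0)) := by
  have hα0 : 0 < α := by linarith
  -- Clamping time to [0, b] makes the path globally Hölder and constant after b, so that g(t + ε)
  -- is meaningful and g - G(b) vanishes beyond b.
  set cl : ℝ → ℝ := fun s => max 0 (min s b) with hcl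
  have hclm : ∀ s, cl s ∈ Icc 0 b := fun s => ⟨le_max_left _ _, max_le hb.le (min_le_right _ _)⟩
  have hcle : ∀ s ∈ Icc 0 b, cl s = s := fun s hs => by
    simp only [hcl, min_eq_left hs.2, max_eq_right hs.1]
  have hclb : ∀ s, b ≤ s → cl s = b := fun s hs => by
    simp only [hcl, min_eq_right hs, max_eq_right hb.le]
  have hcl1 : ∀ s u, |cl s - cl u| ≤ |s - u| := fun s u => by
    refine (abs_max_sub_max_le_max 0 (min s b) 0 (min u b)).trans ?_
    rw [sub_self, abs_zero, max_eq_right (abs_nonneg _)]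
    refine (abs_min_sub_min_le_max s b u b).trans ?_
    rw [sub_self, abs_zero, max_eq_left (abs_nonneg _)]
  set g : ℝ → ℝ := fun s => G (cl s) with hg
  have hge : ∀ s ∈ Icc 0 b, g s = G s := fun s hs => by simp only [hg, hcle s hs]
  have hgb : ∀ s, b ≤ s → g s = G b := fun s hs => by simp only [hg, hclb s hs]
  have hgH : ∀ s u, |g s - g u| ≤ K * |s - u| ^ α := fun s u =>
    (hG _ (hclm s) _ (hclm u)).trans
      (mul_le_mul_of_nonneg_left (Real.rpow_le_rpow (abs_nonneg _) (hcl1 s u) hα0.le) hK)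
  have hgc : Continuous g := by
    rw [continuous_iff_continuousAt]
    intro s
    rw [ContinuousAt, tendsto_iff_dist_tendsto_zero]
    have h0 : Tendsto (fun u : ℝ => K * |u - s| ^ α) (𝓝 s) (𝓝 0) := by
      have : ContinuousAt (fun u : ℝ => K * |u - s| ^ α) s :=
        
        ContinuousAt.mul continuousAt_const
          (ContinuousAt.rpow_const (f := fun u => |u - s|) (by fun_prop) (Or.inr hα0.le))
      have h1 := this.tendsto
      simpa [Real.zero_rpow hα0.ne'] using h1
    exact squeeze_zero (fun _ => dist_nonneg) (fun u => hgH u s) h0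
  obtain ⟨R, hR⟩ : ∃ R, ∀ s, |g s| ≤ R := by
    refine ⟨K * b ^ α + |G 0|, fun s => ?_⟩
    have h1 := hG _ (hclm s) 0 ⟨le_rfl, hb.le⟩
    have h2 : |g s| ≤ |g s - G 0| + |G 0| := by
      simpa using abs_add_le (g s - G 0) (G 0)
    refine h2.trans (add_le_add_left (h1.trans ?_) _)
    rw [sub_zero, abs_of_nonneg (hclm s).1]
    exact mul_le_mul_of_nonneg_left (Real.rpow_le_rpow (hclm s).1 (hclm s).2 hα0.le) hK
  have hVV : ∀ {x y δ : ℝ}, |y - x| ≤ δ → |f' x - f' y| ≤ V (x + δ) - V (x - δ) := by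
    intro x y δ h
    rw [abs_le] at h
    rcases le_total x y with hxy | hxy
    · rw [abs_sub_comm]
      exact (hfV x y hxy).trans (sub_le_sub (hV (by linarith)) (hV (by linarith)))
    · exact (hfV y x hxy).trans (sub_le_sub (hV (by linarith)) (hV (by linarith)))
  -- No rate of decay at 0 is available for F; boundedness suffices for an L¹ derivative, as
  -- s^(-1/2) is integrable.
  set F : ℝ → ℝ := fun s => f' (g s) - Fa with hF
  have hFm : Measurable F := (hf'm.comp hgc.measurable).sub_const _
  obtain ⟨M, hM⟩ : ∃ M, ∀ s, |F s| ≤ M := by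
    refine ⟨V (0 + R) - V (0 - R) + |f' 0 - Fa|, fun s => ?_⟩
    have h1 : |f' 0 - f' (g s)| ≤ V (0 + R) - V (0 - R) := hVV (by simpa using hR s)
    rw [abs_sub_comm] at h1
    have h2 := abs_add_le (f' (g s) - f' 0) (f' 0 - Fa)
    rw [sub_add_sub_cancel] at h2
    linarith
  have hint : Integrable (fun z : ℝ × ℝ => (F z.1 - F z.2) * shiftKernel 0 (z.1 - z.2))
      ((volume.restrict (Ioo 0 b)).prod (volume.restrict (Ioo 0 b))) := by
    refine integrable_marchaud_of_modulus
      (H := fun s v => V (G s + K * v ^ α) - V (G s - K * v ^ α)) hFm (fun s hs u hu => ?_) hfin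
    have h1 := hgH u s
    rw [abs_sub_comm u s, abs_of_pos (by linarith [hu.2] : 0 < s - u)] at h1
    simp only [hF, sub_sub_sub_cancel_right]
    rw [← hge s ⟨hs.1.le, hs.2.le⟩]
    exact hVV h1
  have hφi := integrableOn_marchaud hFm hM hint
  have hφ := isLeftFracDeriv_marchaud hFm hM hint
  obtain ⟨ψ, C, hψm, hψC, hψ⟩ := exists_rightFracDeriv_of_holder (G := fun s => g s - G b)
    (b := b) (M := R + |G b|) hα hK (hgc.measurable.sub_const _)
    (fun s => (abs_sub _ _).trans (add_le_add_left (hR s) _)) (by simp [hgb b le_rfl])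
    (fun s u hus => by
      have := hgH s u
      rw [abs_of_nonneg (sub_nonneg.2 hus)] at this
      simpa using this)
  have L1 := tendsto_setIntegral_mul_diffQuot (G := fun s => g s - G b) hφi hψm hψC hφ hψ
    (fun t ht => by simp [hgb t ht])
  simp only [sub_sub_sub_cancel_right] at L1
  have L2 := tendsto_setIntegral_diffQuot hgc hb.le
  have L3 := tendsto_setIntegral_diffQuot (hfc.comp hgc) hb.le
  simp only [Function.comp_apply] at L3
  have hdi : ∀ ε : ℝ, IntegrableOn (fun t => (g (t + ε) - g t) / ε) (Ioo 0 b) := fun ε =>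
    (Continuous.integrableOn_Icc (by fun_prop)).mono_set Ioo_subset_Icc_self
  have hfi : ∀ ε : ℝ, IntegrableOn (fun t => (f (g (t + ε)) - f (g t)) / ε) (Ioo 0 b) := fun ε =>
    (Continuous.integrableOn_Icc (by fun_prop)).mono_set Ioo_subset_Icc_self
  have hFdi : ∀ ε : ℝ, IntegrableOn (fun t => F t * ((g (t + ε) - g t) / ε)) (Ioo 0 b) :=
    fun ε => (hdi ε).bdd_mul hFm.aestronglyMeasurable (ae_of_all _ hM)
  have L4 : Tendsto (fun ε : ℝ => ∫ t in Ioo 0 b, ((f (g (t + ε)) - f (g t)) / ε -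
      (F t * ((g (t + ε) - g t) / ε) + Fa * ((g (t + ε) - g t) / ε)))) (𝓝[>] 0) (𝓝 0) := by
    set I := ∫⁻ s in Ioo 0 b, ∫⁻ v in Ioo 0 b,
      ENNReal.ofReal (V (G s + K * v ^ α) - V (G s - K * v ^ α)) *
        ENNReal.ofReal (v ^ (-(3 / 2) : ℝ)) with hI
    rw [tendsto_zero_iff_enorm_tendsto_zero]
    -- The exponent is (α - 1) + 1/2: the Taylor bound divided by ε gives ε^(α-1), and
    -- `lintegral_modulus_le` gives 2^(3/2) ε^(1/2).
    have hup : Tendsto (fun ε : ℝ => ENNReal.ofReal (K * 2 ^ (3 / 2 : ℝ) * ε ^ (α - 1 / 2)) * I)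
        (𝓝[>] 0) (𝓝 0) := by
      have h1 : Tendsto (fun ε : ℝ => K * 2 ^ (3 / 2 : ℝ) * ε ^ (α - 1 / 2)) (𝓝[>] 0) (𝓝 0) := by
        have : ContinuousAt (fun ε : ℝ => ε ^ (α - 1 / 2)) 0 :=
          ContinuousAt.rpow_const continuousAt_id (Or.inr (by linarith))
        have h2 := (this.tendsto.mono_left (nhdsWithin_le_nhds (s := Ioi 0))).const_mul
          (K * 2 ^ (3 / 2 : ℝ))
        rwa [Real.zero_rpow (by linarith), mul_zero] at h2
      have h3 := ENNReal.Tendsto.mul_const (ENNReal.tendsto_ofReal h1) (Or.inr hfin.ne)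
      simpa using h3
    refine tendsto_of_tendsto_of_tendsto_of_le_of_le' tendsto_const_nhds hup
      (Eventually.of_forall fun _ => zero_le) ?_
    filter_upwards [self_mem_nhdsWithin,
      nhdsWithin_le_nhds (Iio_mem_nhds (show (0 : ℝ) < b / 2 by linarith))] with ε hε hεb
    have hε' : 0 < ε := hε
    have hεb' : 2 * ε ≤ b := by linarith [mem_Iio.1 hεb]
    have hm : ∀ s, Monotone fun x => V (G s + x) - V (G s - x) := fun s x y hxy =>
      sub_le_sub (hV (by linarith)) (hV (by linarith))
    have hle := lintegral_modulus_le (m := fun s x => V (G s + x) - V (G s - x)) hm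
      hα0.le hK hε' hεb'
    calc _ ≤ ∫⁻ t in Ioo 0 b, ENNReal.ofReal (K * ε ^ α / ε) *
            ENNReal.ofReal (V (G t + K * ε ^ α) - V (G t - K * ε ^ α)) := by
          refine (enorm_integral_le_lintegral_enorm _).trans
            (setLIntegral_mono' measurableSet_Ioo fun t ht => ?_)
          have h1 := hgH (t + ε) t
          rw [add_sub_cancel_left, abs_of_pos hε'] at h1
          have h2 := hT _ _ _ h1
          rw [hge t ⟨ht.1.le, ht.2.le⟩] at h2
          have h3 : (f (g (t + ε)) - f (g t)) / ε -
              (F t * ((g (t + ε) - g t) / ε) + Fa * ((g (t + ε) - g t) / ε)) =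
              (f (g (t + ε)) - f (G t) - f' (G t) * (g (t + ε) - G t)) / ε := by
            simp only [hF, hge t ⟨ht.1.le, ht.2.le⟩]; ring
          rw [hge t ⟨ht.1.le, ht.2.le⟩] at h1
          rw [h3, Real.enorm_eq_ofReal_abs, ← ENNReal.ofReal_mul (by positivity), abs_div,
            abs_of_pos hε', div_mul_eq_mul_div]
          refine ENNReal.ofReal_le_ofReal (div_le_div_of_nonneg_right (h2.trans ?_) hε'.le)
          refine mul_le_mul_of_nonneg_right h1 (sub_nonneg.2 (hV ?_))
          have : 0 ≤ K * ε ^ α := by positivity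
          linarith
      _ = ENNReal.ofReal (K * 2 ^ (3 / 2 : ℝ) * ε ^ (α - 1 / 2)) *
          ((∫⁻ s in Ioo 0 b, ENNReal.ofReal (V (G s + K * ε ^ α) - V (G s - K * ε ^ α))) *
            ENNReal.ofReal ((2 * ε) ^ (-(3 / 2) : ℝ) * ε)) := by
          rw [lintegral_const_mul' _ _ ENNReal.ofReal_ne_top, mul_comm (∫⁻ _ in _, _),
            ← mul_assoc, ← ENNReal.ofReal_mul (by positivity)]
          congr 2
          have h1 : ε ^ α = ε ^ (α - 1 / 2) * ε ^ (1 / 2 : ℝ) := by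
            rw [← Real.rpow_add hε']; ring_nf
          have h2 : ε ^ (-(3 / 2) : ℝ) * ε * ε = ε ^ (1 / 2 : ℝ) := by
            rw [mul_assoc, ← Real.rpow_two ε |>.trans (sq ε) , ← Real.rpow_add hε']; norm_num
          have h3 : (2 : ℝ) ^ (3 / 2 : ℝ) * 2 ^ (-(3 / 2) : ℝ) = 1 := by
            rw [← Real.rpow_add (by norm_num)]; norm_num
          rw [Real.mul_rpow (by norm_num) hε'.le, div_eq_iff hε'.ne', h1, ← h2]
          linear_combination (-K * ε ^ (α - 1 / 2) * (ε ^ (-(3 / 2) : ℝ) * ε * ε)) * h3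
      _ ≤ _ := mul_le_mul_right hle _
  have hval : f (G b) - f (G 0) = -(∫ t in Ioo 0 b, marchaud F t * ψ t) + Fa * (G b - G 0) := by
    have L5 := L3.sub (L1.add (L2.const_mul Fa))
    have h0 : (0 : ℝ) = _ := tendsto_nhds_unique (L4.congr fun ε => ?_) L5
    · rw [hge b ⟨hb.le, le_rfl⟩, hge 0 ⟨le_rfl, hb.le⟩] at h0
      linarith
    · rw [integral_sub (hfi ε) (g := fun t => F t * ((g (t + ε) - g t) / ε) +
          Fa * ((g (t + ε) - g t) / ε)) ((hFdi ε).add ((hdi ε).const_mul Fa)),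
        integral_add (hFdi ε) ((hdi ε).const_mul Fa), integral_const_mul]
  have hGa : Tendsto G (𝓝[>] 0) (𝓝 (G 0)) := by
    have h1 := (hgc.tendsto 0).mono_left (nhdsWithin_le_nhds (s := Ioi 0))
    rw [hge 0 ⟨le_rfl, hb.le⟩] at h1
    refine h1.congr' ?_
    filter_upwards [Ioo_mem_nhdsGT hb] with s hs using hge s ⟨hs.1.le, hs.2.le⟩
  have hGb : Tendsto G (𝓝[<] b) (𝓝 (G b)) := by
    have h1 := (hgc.tendsto b).mono_left (nhdsWithin_le_nhds (s := Iio b))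
    rw [hge b ⟨hb.le, le_rfl⟩] at h1
    refine h1.congr' ?_
    filter_upwards [Ioo_mem_nhdsLT hb] with s hs using hge s ⟨hs.1.le, hs.2.le⟩
  refine Or.inr ⟨hb, Fa, G 0, G b, hlim, hGa, hGb, 1 / 2, ⟨by norm_num, by norm_num⟩, 1, ⊤,
    inferInstance, marchaud F, ψ, ⟨memLp_one_iff_integrable.2 hφi, ?_⟩, ⟨?_, ?_⟩, hval⟩
  · filter_upwards [hφ, ae_restrict_mem measurableSet_Ioo] with t ht htb
    rw [← ht, hF]
    simp only [hge t ⟨htb.1.le, htb.2.le⟩]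
  · exact memLp_top_of_bound hψm C ((ae_restrict_mem measurableSet_Ioo).mono hψC)
  · rw [show (1 : ℝ) - 1 / 2 = 1 / 2 by norm_num]
    filter_upwards [hψ, ae_restrict_mem measurableSet_Ioo] with t ht htb
    rw [← ht]
    simp only [hge t ⟨htb.1.le, htb.2.le⟩]

/-! ### Spatial averages and occupation integrals -/

/-- After translation the two integrals cancel except on windows of length 2δ around N and -N, where
V is bounded by its extreme values. Continuity of V plays no role. -/
lemma Monotone.lintegral_sub_le {V : ℝ → ℝ} (hV : Monotone V) {N δ : ℝ} (hN : 0 ≤ N)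
    (hδ : 0 ≤ δ) :
    ∫⁻ x in Icc (-N) N, ENNReal.ofReal (V (x + δ) - V (x - δ)) ≤
      ENNReal.ofReal (2 * δ * (V (N + δ) - V (-N - δ))) := by
  have hi : ∀ a b, IntervalIntegrable V volume a b := fun a b => hV.intervalIntegrable
  have hp : IntervalIntegrable (fun x => V (x + δ)) volume (-N) N :=
    Monotone.intervalIntegrable fun x y h => hV (by linarith)
  have hm : IntervalIntegrable (fun x => V (x - δ)) volume (-N) N :=
    Monotone.intervalIntegrable fun x y h => hV (by linarith)
  have hle : -N ≤ N := by linarith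
  rw [← restrict_Ioc_eq_restrict_Icc, ← ofReal_integral_eq_lintegral_ofReal
    (f := fun x => V (x + δ) - V (x - δ)) (hp.1.sub hm.1)
    (ae_of_all _ fun x => sub_nonneg.2 (hV (by linarith)))]
  refine ENNReal.ofReal_le_ofReal ?_
  rw [← intervalIntegral.integral_of_le hle, intervalIntegral.integral_sub hp hm,
    intervalIntegral.integral_comp_add_right, intervalIntegral.integral_comp_sub_right,
    intervalIntegral.integral_interval_sub_interval_comm' (hi _ _) (hi _ _) (hi _ _)]
  have h1 : ∫ x in (N - δ)..(N + δ), V x ≤ 2 * δ * V (N + δ) := by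
    have := intervalIntegral.integral_mono_on (by linarith : N - δ ≤ N + δ) (hi _ _)
      (intervalIntegrable_const (c := V (N + δ))) fun x hx => hV hx.2
    rw [intervalIntegral.integral_const, smul_eq_mul] at this
    linarith
  have h2 : 2 * δ * V (-N - δ) ≤ ∫ x in (-N - δ)..(-N + δ), V x := by
    have := intervalIntegral.integral_mono_on (by linarith : -N - δ ≤ -N + δ)
      (intervalIntegrable_const (c := V (-N - δ))) (hi _ _) fun x hx => hV hx.1
    rw [intervalIntegral.integral_const, smul_eq_mul] at this
    linarith
  linarith

lemma measurable_modulus {V : ℝ → ℝ} (hV : Monotone V) (K α : ℝ) :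
    Measurable fun z : ℝ × ℝ => ENNReal.ofReal (V (z.1 + K * z.2 ^ α) - V (z.1 - K * z.2 ^ α)) *
      ENNReal.ofReal (z.2 ^ (-(3 / 2) : ℝ)) := by
  have hv : Measurable fun z : ℝ × ℝ => K * z.2 ^ α := (measurable_snd.pow_const _).const_mul _
  exact (((hV.measurable.comp (measurable_fst.add hv)).sub
    (hV.measurable.comp (measurable_fst.sub hv))).ennreal_ofReal).mul
    (measurable_snd.pow_const _).ennreal_ofReal

/-- By Tonelli, integrate in x first: the result is O(v^α), with constant governed by the increment
c of V over the widest window, v = T. Then v^(α - 3/2) is integrable since α > 1/2. -/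
lemma lintegral_lintegral_modulus_lt_top {V : ℝ → ℝ} (hV : Monotone V) {K α N T : ℝ}
    (hα : 1 / 2 < α) (hK : 0 ≤ K) (hN : 0 ≤ N) :
    ∫⁻ x in Icc (-N) N, ∫⁻ v in Ioo 0 T,
      ENNReal.ofReal (V (x + K * v ^ α) - V (x - K * v ^ α)) *
        ENNReal.ofReal (v ^ (-(3 / 2) : ℝ)) < ∞ := by
  rw [lintegral_lintegral_swap (measurable_modulus hV K α).aemeasurable]
  set c := V (N + K * T ^ α) - V (-N - K * T ^ α)
  rcases le_or_gt T 0 with hT | hT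
  · simp [Ioo_eq_empty (not_lt.2 hT)]
  have hc : 0 ≤ c := by
    have : 0 ≤ K * T ^ α := by positivity
    exact sub_nonneg.2 (hV (by linarith))
  refine lt_of_le_of_lt (setLIntegral_mono' measurableSet_Ioo fun v hv => ?_)
    (lintegral_rpow_mul_rpow_lt_top (K := 2 * K * c) (b := T) hα (by positivity))
  have hv0 : 0 < v := hv.1
  rw [lintegral_mul_const' _ _ ENNReal.ofReal_ne_top]
  refine mul_le_mul_left ((hV.lintegral_sub_le hN (by positivity)).trans
    (ENNReal.ofReal_le_ofReal ?_)) _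
  have h1 : K * v ^ α ≤ K * T ^ α :=
    mul_le_mul_of_nonneg_left (Real.rpow_le_rpow hv0.le hv.2.le (by linarith)) hK
  have h2 : V (N + K * v ^ α) - V (-N - K * v ^ α) ≤ c :=
    sub_le_sub (hV (by linarith)) (hV (by linarith))
  calc 2 * (K * v ^ α) * (V (N + K * v ^ α) - V (-N - K * v ^ α))
      ≤ 2 * (K * v ^ α) * c := mul_le_mul_of_nonneg_left h2 (by positivity)
    _ = _ := by ring

/-- The occupation integral of an integrable function along a process with integrably bounded
densities is almost surely finite. -/
lemma HasIntegrablyBoundedDensities.ae_lintegral_lt_top {Ω : Type*} [MeasurableSpace Ω]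
    {P : Measure Ω} [SFinite P] {Y : ℝ → Ω → ℝ} {T : ℝ}
    (hdens : HasIntegrablyBoundedDensities P Y T) (hY : Measurable (Function.uncurry Y))
    {Ψ : ℝ → ℝ≥0∞} (hΨ : Measurable Ψ) (hfin : ∫⁻ x, Ψ x < ∞) :
    ∀ᵐ ω ∂P, ∫⁻ s in Ioo 0 T, Ψ (Y s ω) < ∞ := by
  obtain ⟨phat, hphat, hp⟩ := hdens
  have hm : Measurable fun z : Ω × ℝ => Ψ (Y z.2 z.1) := hΨ.comp (hY.comp measurable_swap)
  -- It suffices that the expectation is finite. After Tonelli, the density bound replaces the law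
  -- of Y_s by `phat s` times Lebesgue measure.
  refine ae_lt_top hm.lintegral_prod_right' (ne_of_lt ?_)
  rw [lintegral_lintegral_swap hm.aemeasurable]
  have hle : ∀ᵐ s ∂(volume.restrict (Ioo 0 T)),
      ∫⁻ ω, Ψ (Y s ω) ∂P ≤ ENNReal.ofReal (phat s) * ∫⁻ x, Ψ x := by
    filter_upwards [ae_restrict_of_ae_restrict_of_subset Ioo_subset_Icc_self hp] with s hs
    obtain ⟨p, hpm, -, hmap, hple⟩ := hs
    rw [← lintegral_map hΨ hY.of_uncurry_left, hmap,
      lintegral_withDensity_eq_lintegral_mul _ hpm.ennreal_ofReal hΨ,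
      ← lintegral_const_mul _ hΨ]
    exact lintegral_mono fun x => mul_le_mul_left (ENNReal.ofReal_le_ofReal (hple x)) _
  refine (lintegral_mono_ae hle).trans_lt ?_
  rw [lintegral_mul_const' _ _ hfin.ne]
  exact ENNReal.mul_lt_top (hphat.mono_set Ioo_subset_Icc_self).lintegral_lt_top hfin

/-- A process with Hölder paths has a jointly measurable modification on `[0,T]`, which agrees with
it on a measurable set of full measure. -/
lemma HasHolderPaths.exists_measurable_modification {Ω : Type*} [MeasurableSpace Ω]
    {P : Measure Ω} {X : ℝ → Ω → ℝ} {T : ℝ} (hT : 0 ≤ T) {α : ℝ≥0} (hα : 0 < α)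
    (hX : ∀ t ∈ Icc 0 T, Measurable (X t)) (h : HasHolderPaths P X T α) :
    ∃ Y : ℝ → Ω → ℝ, Measurable (Function.uncurry Y) ∧
      ∀ᵐ ω ∂P, ∀ t ∈ Icc 0 T, Y t ω = X t ω := by
  -- The bad paths are set to 0 on a measurable null set, so every section stays measurable and
  -- every path is continuous, which gives joint measurability.
  obtain ⟨B, hB, hBm, hB0⟩ := exists_measurable_superset_of_null (ae_iff.1 h)
  set cl : ℝ → ℝ := fun s => max 0 (min s T) with hcl
  have hclm : ∀ s, cl s ∈ Icc 0 T := fun s => ⟨le_max_left _ _, max_le hT (min_le_right _ _)⟩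
  classical
  refine ⟨fun s ω => if ω ∈ B then 0 else X (cl s) ω,
    measurable_uncurry_of_continuous_of_measurable (fun ω => ?_) fun s =>
      Measurable.ite hBm measurable_const (hX _ (hclm s)), ?_⟩
  · by_cases hω : ω ∈ B
    · simpa only [if_pos hω] using continuous_const
    · simp only [if_neg hω]
      have : ∃ C : ℝ≥0, HolderOnWith C α (fun t => X t ω) (Icc 0 T) := by
        by_contra hc; exact hω (hB hc)
      obtain ⟨C, hC⟩ := this
      exact (hC.continuousOn hα).comp_continuous (by fun_prop) hclm
  · filter_upwards [measure_eq_zero_iff_ae_notMem.1 hB0] with ω hω t ht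
    simp only [if_neg hω, hcl, min_eq_left ht.2, max_eq_right ht.1]

lemma HasIntegrablyBoundedDensities.congr {Ω : Type*} [MeasurableSpace Ω] {P : Measure Ω}
    {X Y : ℝ → Ω → ℝ} {T : ℝ} (h : HasIntegrablyBoundedDensities P X T)
    (hXY : ∀ᵐ ω ∂P, ∀ t ∈ Icc 0 T, Y t ω = X t ω) : HasIntegrablyBoundedDensities P Y T := by
  obtain ⟨phat, hphat, hp⟩ := h
  refine ⟨phat, hphat, ?_⟩
  filter_upwards [hp, ae_restrict_mem measurableSet_Icc] with t ht htT
  obtain ⟨p, hpm, hp0, hmap, hple⟩ := ht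
  exact ⟨p, hpm, hp0, (Measure.map_congr (hXY.mono fun ω hω => hω t htT)).trans hmap, hple⟩

/-! ### The almost sure chain rule -/

theorem theorem2 {Ω : Type*} [MeasurableSpace Ω] (P : Measure Ω) [IsProbabilityMeasure P]
    (T : ℝ) (hT : 0 < T) (X : ℝ → Ω → ℝ) (hX : ∀ t ∈ Icc 0 T, Measurable (X t))
    (α : ℝ≥0) (hα : 1 / 2 < α) (hXα : HasHolderPaths P X T α)
    (hdens : HasIntegrablyBoundedDensities P X T)
    (f f' : ℝ → ℝ) (hf : ∀ a b : ℝ, AbsolutelyContinuousOnInterval f a b)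
    (hff' : ∀ᵐ x : ℝ, HasDerivAt f (f' x) x)
    (hf' : LocallyBoundedVariationOn f' univ)
    (h0 : ∀ᵐ ω ∂P, ∃ l : ℝ, Tendsto (fun t => f' (X t ω)) (𝓝[>] 0) (𝓝 l)) :
    ∀ t ∈ Icc 0 T, ∀ᵐ ω ∂P,
      HasZSIntegral (fun s => f' (X s ω)) (fun s => X s ω) 0 t (f (X t ω) - f (X 0 ω)) := by
  intro b hbT
  rcases hbT.1.eq_or_lt with rfl | hb
  · exact ae_of_all _ fun ω => Or.inl ⟨rfl, sub_self _⟩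
  have hαr : (1 / 2 : ℝ) < α := by exact_mod_cast hα
  have hα0 : (0 : ℝ) < α := by linarith
  obtain ⟨p, q, hp, hq, hpq⟩ := hf'.exists_monotoneOn_sub_monotoneOn
  rw [monotoneOn_univ] at hp hq
  -- With f' = p - q, the sum p + q dominates every increment of f'.
  set V : ℝ → ℝ := fun x => p x + q x with hVdef
  have hV : Monotone V := fun x y h => add_le_add (hp h) (hq h)
  have hfV : ∀ x y, x ≤ y → |f' y - f' x| ≤ V y - V x := fun x y h => by
    have h1 := hp h
    have h2 := hq h
    simp only [hpq, Pi.sub_apply, hVdef, abs_le]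
    constructor <;> linarith
  have hf'm : Measurable f' := hpq ▸ hp.measurable.sub hq.measurable
  have hfc : Continuous f := continuous_iff_continuousAt.2 fun x =>
    ((hf (x - 1) (x + 1)).continuousOn).continuousAt
      (by rw [uIcc_of_le (by linarith)]; exact Icc_mem_nhds (by linarith) (by linarith))
  obtain ⟨Y, hYm, hYX⟩ := hXα.exists_measurable_modification hT.le (by exact_mod_cast hα0) hX
  -- The Hölder constant and the bound of the path are random; one null set is fixed for all natural
  -- K and N, which are then chosen path by path.
  have hfin : ∀ᵐ ω ∂P, ∀ K N : ℕ, ∫⁻ s in Ioo 0 T, (Icc (-(N : ℝ)) N).indicator (fun x =>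
      ∫⁻ v in Ioo 0 T, ENNReal.ofReal (V (x + K * v ^ (α : ℝ)) - V (x - K * v ^ (α : ℝ))) *
        ENNReal.ofReal (v ^ (-(3 / 2) : ℝ))) (Y s ω) < ∞ := by
    rw [ae_all_iff]; intro K
    rw [ae_all_iff]; intro N
    refine (hdens.congr hYX).ae_lintegral_lt_top hYm
      ((measurable_modulus hV K α).lintegral_prod_right'.indicator measurableSet_Icc) ?_
    rw [lintegral_indicator measurableSet_Icc]
    exact lintegral_lintegral_modulus_lt_top hV hαr (Nat.cast_nonneg K) (Nat.cast_nonneg N)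
  filter_upwards [hXα, h0, hYX, hfin] with ω ⟨C, hC⟩ ⟨l, hl⟩ hω hfinω
  obtain ⟨K, hK⟩ := exists_nat_ge (C : ℝ)
  have hKX : ∀ s ∈ Icc 0 T, ∀ u ∈ Icc 0 T, |X s ω - X u ω| ≤ K * |s - u| ^ (α : ℝ) :=
    fun s hs u hu => (hC.dist_le hs hu).trans
      (mul_le_mul_of_nonneg_right hK (Real.rpow_nonneg (abs_nonneg _) _))
  obtain ⟨N, hN⟩ : ∃ N : ℕ, ∀ s ∈ Icc 0 T, |X s ω| ≤ N := by
    obtain ⟨R, hR⟩ := isCompact_Icc.exists_bound_of_continuousOn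
      (hC.continuousOn (by exact_mod_cast hα0))
    obtain ⟨N, hN⟩ := exists_nat_ge R
    exact ⟨N, fun s hs => (hR s hs).trans hN⟩
  have hbIcc : Icc 0 b ⊆ Icc 0 T := Icc_subset_Icc_right hbT.2
  refine hasZSIntegral_of_modulus (V := V) (G := fun s => X s ω) hb hαr (Nat.cast_nonneg K)
    (fun s hs u hu => hKX s (hbIcc hs) u (hbIcc hu)) hV hfV hf'm hfc
    (fun x y δ h => abs_sub_sub_mul_le hf hff' hV hfV h) ?_ hl
  refine lt_of_le_of_lt ?_ (hfinω K N)
  refine le_trans ?_ (lintegral_mono_set (Ioo_subset_Ioo_right hbT.2))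
  refine setLIntegral_mono' measurableSet_Ioo fun s hs => ?_
  have hsT : s ∈ Icc 0 T := ⟨hs.1.le, hs.2.le.trans hbT.2⟩
  rw [hω s hsT, indicator_of_mem (show X s ω ∈ Icc (-(N : ℝ)) N from abs_le.1 (hN s hsT))]
  exact lintegral_mono_set (Ioo_subset_Ioo_right hbT.2)
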